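/- Let $(Z_n)$ be a branching process with immigration in an i.i.d. random environment $\xi=(\xi_0,\xi_1,\dots)$ with values in a measurable space $\Theta$: each state $\theta\in\Theta$ determines an offspring distribution $p(\theta)=\{p_k(\theta)\}_{k\ge 0}$ and an immigration distribution $h(\theta)=\{h_k(\theta)\}_{k\ge 0}$ on $\{0,1,2,\dots\}$; given $\xi$, the variables $X_{n,i}$ $(n\ge 0,\ i\ge 1)$ and $Y_n$ $(n\ge 0)$ are all independent, $X_{n,i}$ has distribution $p(\xi_n)$ and $Y_n$ has distribution $h(\xi_n)$; and $$Z_0=1,\qquad Z_{n+1}=Y_n+\sum_{i=1}^{Z_n}X_{n,i}\quad(n\ge 0).$$ Write $X_0=X_{0,1}$, let $\mathbb P$ and $\mathbb E$ be the total (annealed) probability and expectation and $\mathbb E_\xi$ the (quenched) expectation given the environment $\xi$, and set $$m_n=\sum_{k\ge 0}k\,p_k(\xi_n),\qquad W_n=\frac{Z_n}{m_0m_1\cdots m_{n-1}}\quad(W_0=1).$$ Assume $\mathbb P(X_0=0)=0$ and $\mathbb P(X_0=1)<1$. Let $a>0$, and suppose that for some $\delta>0$, $\varepsilon>0$ and $p>1$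 $$\mathbb E\Big(\frac{Y_0}{m_0}\Big)^{\delta}<\infty,\qquad \mathbb E(\log m_0)^a<\infty,\qquad \mathbb E\Big(\mathbb E_\xi\Big(\frac{X_0}{m_0}\Big)^p\Big)^{\varepsilon}<\infty .$$ Then $W_n$ converges almost surely to a limit $W$, and for every $r\in(0,a)$ $$\sup_{n\ge 0}\mathbb E|\log W_n|^r<\infty\qquad\text{and}\qquad \mathbb E|\log W|^r<\infty ,$$ where $|\log 0|=|\log\infty|=\infty$ (so that, in particular, $0<W<\infty$ almost surely). -/

import Mathlib

open MeasureTheory ProbabilityTheory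
open scoped ENNReal

namespace BPIRE

/-- A product of probability measures depending measurably on a parameter depends measurably on
that parameter. -/
theorem measurable_infinitePi_kernel {α ι : Type*} [MeasurableSpace α] {S : ι → Type*}
    [∀ i, MeasurableSpace (S i)] (κ : ∀ i, Kernel α (S i)) [∀ i, IsMarkovKernel (κ i)] :
    Measurable fun a => Measure.infinitePi fun i => κ i a := by
  refine Measurable.measure_of_isPiSystem_of_isProbabilityMeasure
    generateFrom_squareCylinders.symm
    (isPiSystem_squareCylinders (fun i => MeasurableSpace.isPiSystem_measurableSet)
      (fun i => MeasurableSet.univ)) ?_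
  rintro _ ⟨s, t, ht, rfl⟩
  have ht' : ∀ i, MeasurableSet (t i) := fun i => ht i (Set.mem_univ i)
  have h : (fun a => Measure.infinitePi (fun i => κ i a) ((s : Set ι).pi t))
      = fun a => ∏ i ∈ s, κ i a (t i) := by
    funext a
    exact Measure.infinitePi_pi _ fun i _ => ht' i
  rw [h]
  exact Finset.measurable_prod _ fun i _ => Kernel.measurable_coe _ (ht' i)

/-- The product, over an index set `ι`, of probability kernels with a common source. -/
noncomputable def kernelPi {α ι : Type*} [MeasurableSpace α] {S : ι → Type*}
    [∀ i, MeasurableSpace (S i)] (κ : ∀ i, Kernel α (S i)) [∀ i, IsMarkovKernel (κ i)] :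
    Kernel α (∀ i, S i) where
  toFun a := Measure.infinitePi fun i => κ i a
  measurable' := measurable_infinitePi_kernel κ

instance isMarkovKernel_kernelPi {α ι : Type*} [MeasurableSpace α] {S : ι → Type*}
    [∀ i, MeasurableSpace (S i)] (κ : ∀ i, Kernel α (S i)) [∀ i, IsMarkovKernel (κ i)] :
    IsMarkovKernel (kernelPi κ) where
  isProbabilityMeasure a :=
    inferInstanceAs (IsProbabilityMeasure (Measure.infinitePi fun i => κ i a))

theorem measurable_pmf_toMeasure {Θ : Type*} [MeasurableSpace Θ] (q : Θ → PMF ℕ)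
    (hq : ∀ k, Measurable fun θ => q θ k) : Measurable fun θ => (q θ).toMeasure := by
  refine Measure.measurable_of_measurable_coe _ fun s hs => ?_
  simp only [PMF.toMeasure_apply _ hs]
  refine Measurable.tsum fun k => ?_
  by_cases hk : k ∈ s
  · simpa [hk] using hq k
  · simp [hk]

/-- The two families of probability distributions on `ℕ` indexed by the states of the environment:
`offspring θ = {p_k(θ)}` and `immigration θ = {h_k(θ)}`. -/
structure Laws (Θ : Type*) [MeasurableSpace Θ] where
  offspring : Θ → PMF ℕ
  immigration : Θ → PMF ℕ
  measurable_offspring : ∀ k, Measurable fun θ => offspring θ k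
  measurable_immigration : ∀ k, Measurable fun θ => immigration θ k

variable {Θ : Type*} [MeasurableSpace Θ]

namespace Laws

/-- `m(θ) = ∑ k, k p_k(θ)`, the mean of the offspring distribution (possibly `∞`). -/
noncomputable def mean (L : Laws Θ) (θ : Θ) : ℝ≥0∞ := ∑' k : ℕ, (k : ℝ≥0∞) * L.offspring θ k

/-- `e ↦ p(e_n)`, as a kernel from environment sequences. -/
noncomputable def offspringKernel (L : Laws Θ) (n : ℕ) : Kernel (ℕ → Θ) ℕ where
  toFun e := (L.offspring (e n)).toMeasure
  measurable' :=
    (measurable_pmf_toMeasure L.offspring L.measurable_offspring).comp (measurable_pi_apply n)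

/-- `e ↦ h(e_n)`, as a kernel from environment sequences. -/
noncomputable def immigrationKernel (L : Laws Θ) (n : ℕ) : Kernel (ℕ → Θ) ℕ where
  toFun e := (L.immigration (e n)).toMeasure
  measurable' :=
    (measurable_pmf_toMeasure L.immigration L.measurable_immigration).comp (measurable_pi_apply n)

instance (L : Laws Θ) (n : ℕ) : IsMarkovKernel (L.offspringKernel n) where
  isProbabilityMeasure e := PMF.toMeasure.isProbabilityMeasure (L.offspring (e n))

instance (L : Laws Θ) (n : ℕ) : IsMarkovKernel (L.immigrationKernel n) where
  isProbabilityMeasure e := PMF.toMeasure.isProbabilityMeasure (L.immigration (e n))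

/-- The quenched law: given the environment `e`, it is the law on pairs `(x, y)` under which
all the `x n i` and `y n` are independent, `x n i` has distribution `p(e_n)` and `y n` has
distribution `h(e_n)`. -/
noncomputable def quenched (L : Laws Θ) : Kernel (ℕ → Θ) ((ℕ → ℕ → ℕ) × (ℕ → ℕ)) :=
  (kernelPi fun n => kernelPi fun _ : ℕ => L.offspringKernel n) ×ₖ
    (kernelPi fun n => L.immigrationKernel n)

/-- The quenched moment `E_ξ (X_0 / m_0)^p` in the environment `e`. -/
noncomputable def quenchedMoment (L : Laws Θ) (p : ℝ) (e : ℕ → Θ) : ℝ≥0∞ :=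
  ∫⁻ z, ((z.1 0 0 : ℝ≥0∞) / L.mean (e 0)) ^ p ∂(L.quenched e)

end Laws

/-- The random variables driving a branching process with immigration in an i.i.d. random
environment: `ξ n` is the environment at time `n`, `X n i` the number of offspring of the `i`-th
individual of generation `n` (individuals are numbered from `0`), `Y n` the number of immigrants.
The environment is i.i.d., and the joint law of `(ξ, X, Y)` is `P_ξ(dx) τ(dξ)`,
`τ` being the law of `ξ` and `P_ξ` the quenched law. -/
structure IsModel {Ω : Type*} [MeasurableSpace Ω] (P : Measure Ω) (L : Laws Θ)
    (ξ : ℕ → Ω → Θ) (X : ℕ → ℕ → Ω → ℕ) (Y : ℕ → Ω → ℕ) : Prop where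
  measurable_env : ∀ n, Measurable (ξ n)
  measurable_offspring : ∀ n i, Measurable (X n i)
  measurable_immigration : ∀ n, Measurable (Y n)
  indep_env : iIndepFun ξ P
  identDistrib_env : ∀ n, IdentDistrib (ξ n) (ξ 0) P P
  joint_law : P.map (fun ω => ((fun n => ξ n ω), ((fun n i => X n i ω), (fun n => Y n ω))))
    = (P.map fun ω n => ξ n ω) ⊗ₘ L.quenched

/-- Population sizes: `Z_0 = 1`, `Z_{n+1} = Y_n + ∑ X_{n,i}`, the sum being over the `Z_n`
individuals of generation `n`. -/
def Z {Ω : Type*} (X : ℕ → ℕ → Ω → ℕ) (Y : ℕ → Ω → ℕ) : ℕ → Ω → ℕ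
  | 0, _ => 1
  | n + 1, ω => Y n ω + ∑ i ∈ Finset.range (Z X Y n ω), X n i ω

/-- `W_n = Z_n / (m_0 ⋯ m_{n-1})`. -/
noncomputable def W {Ω : Type*} (L : Laws Θ) (ξ : ℕ → Ω → Θ) (X : ℕ → ℕ → Ω → ℕ)
    (Y : ℕ → Ω → ℕ) (n : ℕ) (ω : Ω) : ℝ≥0∞ :=
  (Z X Y n ω : ℝ≥0∞) / ∏ k ∈ Finset.range n, L.mean (ξ k ω)

/-- The limit of `W_n`; it is defined everywhere, as an upper limit in `[0, ∞]`. -/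
noncomputable def limitW {Ω : Type*} (L : Laws Θ) (ξ : ℕ → Ω → Θ) (X : ℕ → ℕ → Ω → ℕ)
    (Y : ℕ → Ω → ℕ) (ω : Ω) : ℝ≥0∞ :=
  Filter.limsup (fun n => W L ξ X Y n ω) Filter.atTop

/-- `|log x|` for `x ∈ [0, ∞]`, with `|log 0| = |log ∞| = ∞`. -/
noncomputable def absLog (x : ℝ≥0∞) : ℝ≥0∞ := (ENNReal.log x).abs

end BPIRE

namespace BPIRE

variable {Θ : Type*} [MeasurableSpace Θ]

/-! All estimates are made given the environment and then averaged over the i.i.d. states. Write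
q(θ) for the mean of 1/X in the state θ (`invMean`). As X ≥ 1 and X is not almost surely 1, q ≤ 1
with mean below 1; hence E q^κ < 1 for every κ > 0. Since 1/m ≤ q, products of 1/m over independent
states decay geometrically in mean. Every rate below comes from this.

Upper side. For δ ≤ 1, subadditivity of x^δ and conditional Jensen show that E_ξ W_n^δ grows at step
n by at most E_ξ (Y_n/(m_0⋯m_n))^δ, and these increments are summable
(`lintegral_normalized_rpow_le`). The same computation makes W_n^δ minus the accumulated immigration
an L¹-bounded supermartingale, so W_n converges (`ae_tendsto_normalized`).

Lower side. Immigration only enlarges Z_n and is dropped. With μ = E_ξ (X/m)^p and p ≤ 2, the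
generating function satisfies f(1-x) ≤ 1 - mx + μ(mx)^p (`pgf_le`). Iterated from time n back to
time j, this bounds E_ξ (1 - s/(m_j⋯m_{n-1}))^{Z_n} by E_ξ (1 - s/2)^{Z_j} when s is small against a
discounted sum of the μ's. Moreover Z_j is large: E_ξ (1/Z_j) ≤ q_0⋯q_{j-1}. Markov's inequality
then gives P(W_n < 1/(m_0⋯m_{j-1})) ≤ K ρ^j with ρ < 1, uniformly in n ≥ j
(`annealed_lowerTail_le`).

If W_n < 1, one of these events occurs for some j with |log W_n| ≤ log m_0 + ⋯ + log m_j
(`absLog_normalized_rpow_le`). The a-th moment of this sum is polynomial in j, so Hölder's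
inequality against K ρ^j leaves a convergent series for every r < a. Fatou's lemma carries the bound
to W. -/

/-! ### Path space, population sizes and the past -/

/-- The numbers of offspring `x n i` and of immigrants `y n`. -/
abbrev Path : Type := (ℕ → ℕ → ℕ) × (ℕ → ℕ)

/-- The population sizes, as functions of the numbers of offspring and of immigrants. -/
def popSize (n : ℕ) (z : Path) : ℕ := Z (fun n i (z : Path) => z.1 n i) (fun n z => z.2 n) n z

@[simp] lemma popSize_zero (z : Path) : popSize 0 z = 1 := rfl

lemma popSize_succ (n : ℕ) (z : Path) :
    popSize (n + 1) z = z.2 n + ∑ i ∈ Finset.range (popSize n z), z.1 n i := rfl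

lemma Z_eq_popSize {Ω : Type*} (X : ℕ → ℕ → Ω → ℕ) (Y : ℕ → Ω → ℕ) (n : ℕ) (ω : Ω) :
    Z X Y n ω = popSize n (fun n i => X n i ω, fun n => Y n ω) := by
  induction n with
  | zero => rfl
  | succ n ih => rw [popSize_succ, ← ih]; rfl

/-- What happens before time `n`: all later variables are replaced by `0`. -/
def past (n : ℕ) (z : Path) : Path :=
  (fun k => if k < n then z.1 k else 0, fun k => if k < n then z.2 k else 0)

lemma measurable_past (n : ℕ) : Measurable (past n) := by
  refine Measurable.prodMk ?_ ?_
  · refine measurable_pi_lambda _ fun k => ?_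
    split_ifs
    · fun_prop
    · fun_prop
  · refine measurable_pi_lambda _ fun k => ?_
    split_ifs
    · fun_prop
    · fun_prop

lemma past_past {m n : ℕ} (h : m ≤ n) (z : Path) : past m (past n z) = past m z := by
  ext k
  · simp only [past]
    split_ifs <;> first | rfl | omega
  · simp only [past]
    split_ifs <;> first | rfl | omega

lemma popSize_past {m n : ℕ} (h : m ≤ n) (z : Path) : popSize m (past n z) = popSize m z := by
  induction m with
  | zero => rfl
  | succ m ih =>
    have hm : m < n := h
    simp only [popSize_succ, ih hm.le]
    simp [past, hm]

lemma measurable_sum_range {α : Type*} [MeasurableSpace α] {N : α → ℕ} (hN : Measurable N)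
    {f : ℕ → α → ℕ} (hf : ∀ i, Measurable (f i)) :
    Measurable fun a => ∑ i ∈ Finset.range (N a), f i a := by
  have : Measurable fun q : ℕ × α => ∑ i ∈ Finset.range q.1, f i q.2 :=
    measurable_from_prod_countable_right fun k =>
      Finset.measurable_sum (Finset.range k) fun i _ => hf i
  exact this.comp (hN.prodMk measurable_id)

@[fun_prop]
lemma measurable_popSize (n : ℕ) : Measurable (popSize n) := by
  induction n with
  | zero => exact measurable_const
  | succ n ih =>
    simp only [funext (popSize_succ n)]
    exact Measurable.add (by fun_prop) (measurable_sum_range ih fun i => by fun_prop)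

/-! ### Independence under the quenched law -/

namespace Laws

instance (L : Laws Θ) (e : ℕ → Θ) : IsProbabilityMeasure (L.quenched e) := by
  unfold quenched; infer_instance

/-- The law of a sequence of independent numbers of offspring in the state `θ`. -/
noncomputable def rowLaw (L : Laws Θ) (θ : Θ) : Measure (ℕ → ℕ) :=
  Measure.infinitePi fun _ => (L.offspring θ).toMeasure

instance (L : Laws Θ) (θ : Θ) : IsProbabilityMeasure (L.offspring θ).toMeasure :=
  PMF.toMeasure.isProbabilityMeasure _

instance (L : Laws Θ) (θ : Θ) : IsProbabilityMeasure (L.immigration θ).toMeasure :=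
  PMF.toMeasure.isProbabilityMeasure _

instance (L : Laws Θ) (θ : Θ) : IsProbabilityMeasure (L.rowLaw θ) := by
  unfold rowLaw; infer_instance

lemma quenched_eq (L : Laws Θ) (e : ℕ → Θ) :
    L.quenched e = (Measure.infinitePi fun n => L.rowLaw (e n)).prod
      (Measure.infinitePi fun n => (L.immigration (e n)).toMeasure) := by
  rw [quenched, Kernel.prod_apply]
  rfl

/-- The coordinates before `n` are independent of coordinate `n`, so the joint law is a product and
Tonelli applies. Padding with `c` keeps the past a full sequence and avoids dependent index types.
-/
lemma lintegral_infinitePi_past_row {α : Type*} [MeasurableSpace α] (ν : ℕ → Measure α)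
    [∀ n, IsProbabilityMeasure (ν n)] (c : α) (n : ℕ) {F : (ℕ → α) → α → ℝ≥0∞}
    (hF : Measurable (Function.uncurry F)) :
    ∫⁻ x, F (fun k => if k < n then x k else c) (x n) ∂(Measure.infinitePi ν)
      = ∫⁻ x, ∫⁻ a, F (fun k => if k < n then x k else c) a ∂(ν n) ∂(Measure.infinitePi ν) := by
  have hind := (iIndepFun_infinitePi (P := ν) (X := fun _ a => a) fun _ => measurable_id)
  have h1 := hind.indepFun_finset (Finset.range n) {n} (by simp) fun i => by fun_prop
  have hφ : Measurable fun (x : Finset.range n → α) (k : ℕ) =>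
      if h : k ∈ Finset.range n then x ⟨k, h⟩ else c := by
    refine measurable_pi_lambda _ fun k => ?_
    split_ifs <;> fun_prop
  have hψ : Measurable fun (x : ({n} : Finset ℕ) → α) => x ⟨n, by simp⟩ := by fun_prop
  have h2 := h1.comp hφ hψ
  have hφ' : Measurable fun (x : ℕ → α) (k : ℕ) => if k < n then x k else c := by
    refine measurable_pi_lambda _ fun k => ?_
    split_ifs <;> fun_prop
  have h3 : IndepFun (fun (x : ℕ → α) (k : ℕ) => if k < n then x k else c) (fun x => x n)
      (Measure.infinitePi ν) := by
    convert h2 using 1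
    ext x k
    simp [Function.comp]
    rfl
  rw [indepFun_iff_map_prod_eq_prod_map_map hφ'.aemeasurable
    (measurable_pi_apply n).aemeasurable] at h3
  have h4 := lintegral_map (μ := Measure.infinitePi ν) hF
    (hφ'.prodMk (measurable_pi_apply n))
  simp only [Function.uncurry] at h4
  rw [← h4, h3, lintegral_prod _ (by exact hF.aemeasurable), Measure.infinitePi_map_eval,
    lintegral_map _ hφ']
  exact Measurable.lintegral_prod_right hF

/-- Given the environment, the offspring numbers of generation `n` are independent of what
happens before time `n`. -/
lemma lintegral_past_row (L : Laws Θ) (e : ℕ → Θ) (n : ℕ) {F : Path → (ℕ → ℕ) → ℝ≥0∞}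
    (hF : Measurable (Function.uncurry F)) :
    ∫⁻ z, F (past n z) (z.1 n) ∂(L.quenched e)
      = ∫⁻ z, ∫⁻ x, F (past n z) x ∂(L.rowLaw (e n)) ∂(L.quenched e) := by
  have hp := measurable_past n
  -- Integrating over the immigrants last leaves, for each fixed `y`, an integral over independent
  -- rows only.
  rw [quenched_eq, lintegral_prod_symm _ (by
      exact (hF.comp (hp.prodMk (by fun_prop))).aemeasurable),
    lintegral_prod_symm]
  · refine lintegral_congr fun y => ?_
    refine lintegral_infinitePi_past_row (fun n => L.rowLaw (e n)) 0 n
      (F := fun x a => F (x, fun k => if k < n then y k else 0) a) ?_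
    exact hF.comp (by fun_prop : Measurable fun q : (ℕ → ℕ → ℕ) × (ℕ → ℕ) =>
      ((q.1, fun k => if k < n then y k else 0), q.2))
  · refine Measurable.aemeasurable ?_
    exact (Measurable.lintegral_prod_right' (f := fun q : Path × (ℕ → ℕ) => F q.1 q.2) hF).comp hp

lemma lintegral_quenched_immigration (L : Laws Θ) (e : ℕ → Θ) (n : ℕ) (f : ℕ → ℝ≥0∞) :
    ∫⁻ z, f (z.2 n) ∂(L.quenched e) = ∫⁻ k, f k ∂(L.immigration (e n)).toMeasure := by
  have hf : Measurable f := measurable_from_top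
  rw [quenched_eq, lintegral_prod _ (by fun_prop)]
  simp only [lintegral_const, measure_univ, mul_one]
  rw [← Measure.infinitePi_map_eval (fun n => (L.immigration (e n)).toMeasure) n,
    lintegral_map hf (by fun_prop)]

lemma lintegral_rowLaw_eval (L : Laws Θ) (θ : Θ) (i : ℕ) (f : ℕ → ℝ≥0∞) :
    ∫⁻ x, f (x i) ∂(L.rowLaw θ) = ∫⁻ k, f k ∂(L.offspring θ).toMeasure := by
  have hf : Measurable f := measurable_from_top
  rw [← Measure.infinitePi_map_eval (fun _ : ℕ => (L.offspring θ).toMeasure) i,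
    lintegral_map hf (by fun_prop)]
  rfl

lemma lintegral_quenched_offspring (L : Laws Θ) (e : ℕ → Θ) (n i : ℕ) (f : ℕ → ℝ≥0∞) :
    ∫⁻ z, f (z.1 n i) ∂(L.quenched e) = ∫⁻ k, f k ∂(L.offspring (e n)).toMeasure := by
  have hf : Measurable f := measurable_from_top
  rw [L.lintegral_past_row e n (F := fun _ x => f (x i)) (by
    exact hf.comp ((measurable_pi_apply i).comp measurable_snd))]
  simp [lintegral_rowLaw_eval]

lemma lintegral_rowLaw_prod (L : Laws Θ) (θ : Θ) (s : Finset ℕ) (f : ℕ → ℝ≥0∞) :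
    ∫⁻ x, ∏ i ∈ s, f (x i) ∂(L.rowLaw θ) = (∫⁻ k, f k ∂(L.offspring θ).toMeasure) ^ s.card := by
  have hf : Measurable f := measurable_from_top
  have hind := (iIndepFun_infinitePi (P := fun _ : ℕ => (L.offspring θ).toMeasure)
    (X := fun _ a => f a) fun _ => hf)
  have := lintegral_prod_eq_prod_lintegral_of_indepFun s _ hind fun i => by fun_prop
  refine this.trans ?_
  rw [← Finset.prod_const]
  exact Finset.prod_congr rfl fun i _ => L.lintegral_rowLaw_eval θ i f

lemma mean_eq_lintegral (L : Laws Θ) (θ : Θ) :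
    L.mean θ = ∫⁻ k, (k : ℝ≥0∞) ∂(L.offspring θ).toMeasure := by
  rw [lintegral_countable']
  refine tsum_congr fun k => ?_
  rw [PMF.toMeasure_apply_singleton _ _ (measurableSet_singleton k)]

lemma lintegral_offspring (L : Laws Θ) (θ : Θ) (f : ℕ → ℝ≥0∞) :
    ∫⁻ k, f k ∂(L.offspring θ).toMeasure = ∑' k, f k * L.offspring θ k := by
  rw [lintegral_countable']
  refine tsum_congr fun k => ?_
  rw [PMF.toMeasure_apply_singleton _ _ (measurableSet_singleton k)]

@[fun_prop]
lemma measurable_lintegral_offspring (L : Laws Θ) (f : ℕ → ℝ≥0∞) :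
    Measurable fun θ => ∫⁻ k, f k ∂(L.offspring θ).toMeasure := by
  simp only [lintegral_offspring]
  exact Measurable.tsum fun k => (L.measurable_offspring k).const_mul _

@[fun_prop]
lemma measurable_mean (L : Laws Θ) : Measurable L.mean := by
  simp only [funext L.mean_eq_lintegral]
  exact L.measurable_lintegral_offspring _

end Laws

/-! ### Moments and inverse moments over one generation -/

/-- Jensen's inequality for a power at most one. -/
lemma lintegral_rpow_le_rpow_lintegral {α : Type*} [MeasurableSpace α] {μ : Measure α}
    [IsProbabilityMeasure μ] {f : α → ℝ≥0∞} (hf : AEMeasurable f μ) {δ : ℝ} (h0 : 0 < δ)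
    (h1 : δ ≤ 1) : ∫⁻ a, f a ^ δ ∂μ ≤ (∫⁻ a, f a ∂μ) ^ δ := by
  -- At `δ = 1` the conjugate exponent `1 / (1 - δ)` degenerates; below it, this is Hölder against
  -- the constant 1.
  rcases h1.eq_or_lt with rfl | h1
  · simp
  have hpq : (1 / δ).HolderConjugate (1 / (1 - δ)) := by
    rw [Real.holderConjugate_iff]
    refine ⟨by rw [lt_div_iff₀ h0]; linarith, by simp⟩
  have := ENNReal.lintegral_mul_le_Lp_mul_Lq μ hpq (hf.pow_const δ)
    (aemeasurable_const (b := (1 : ℝ≥0∞)))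
  simpa [← ENNReal.rpow_mul, h0.ne'] using this

/-- Cauchy–Schwarz: `z² ≤ (∑ x i) (∑ 1 / x i)`. If some `x i` vanishes, the right side is `∞`. -/
lemma inv_sum_natCast_le {z : ℕ} (hz : z ≠ 0) (x : ℕ → ℕ) :
    ((∑ i ∈ Finset.range z, x i : ℕ) : ℝ≥0∞)⁻¹
      ≤ (z : ℝ≥0∞)⁻¹ * ((z : ℝ≥0∞)⁻¹ * ∑ i ∈ Finset.range z, (x i : ℝ≥0∞)⁻¹) := by
  have hz' : (0 : ℝ) < z := by positivity
  by_cases hx : ∀ i ∈ Finset.range z, 0 < x i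
  · have h := Finset.sq_sum_div_le_sum_sq_div (Finset.range z) (fun _ => (1 : ℝ))
      (g := fun i => (x i : ℝ)) fun i hi => by exact_mod_cast hx i hi
    have hs : 0 < ∑ i ∈ Finset.range z, (x i : ℝ) :=
      Finset.sum_pos (fun i hi => by exact_mod_cast hx i hi) ⟨0, by simpa using hz.bot_lt⟩
    have e1 : ∀ k : ℕ, 0 < k → (k : ℝ≥0∞)⁻¹ = ENNReal.ofReal ((k : ℝ)⁻¹) := fun k hk => by
      rw [ENNReal.ofReal_inv_of_pos (by exact_mod_cast hk), ENNReal.ofReal_natCast]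
    rw [Finset.sum_congr rfl fun i hi => e1 _ (hx i hi), e1 z hz.bot_lt,
      e1 _ (Finset.sum_pos hx ⟨0, by simpa using hz.bot_lt⟩),
      ← ENNReal.ofReal_sum_of_nonneg fun i _ => by positivity,
      ← ENNReal.ofReal_mul (by positivity), ← ENNReal.ofReal_mul (by positivity)]
    refine ENNReal.ofReal_le_ofReal ?_
    simp only [Finset.sum_const, Finset.card_range, nsmul_eq_mul, mul_one, one_pow, one_div] at h
    push_cast
    rw [← mul_assoc, ← mul_inv, ← div_eq_inv_mul, le_div_iff₀ (by positivity)]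
    refine le_trans (le_of_eq ?_) h
    field_simp
  · push Not at hx
    obtain ⟨i, hi, hxi⟩ := hx
    have : ∑ i ∈ Finset.range z, (x i : ℝ≥0∞)⁻¹ = ∞ :=
      ENNReal.sum_eq_top.2 ⟨i, hi, by simp [Nat.le_zero.1 hxi]⟩
    rw [this, ENNReal.mul_top (by simp), ENNReal.mul_top (by simp)]
    exact le_top

namespace Laws

/-- The mean of `1 / X` for an offspring number `X` in the state `θ`. -/
noncomputable def invMean (L : Laws Θ) (θ : Θ) : ℝ≥0∞ :=
  ∫⁻ k, (k : ℝ≥0∞)⁻¹ ∂(L.offspring θ).toMeasure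

/-- The generating function of the offspring distribution. -/
noncomputable def pgf (L : Laws Θ) (θ : Θ) (u : ℝ≥0∞) : ℝ≥0∞ :=
  ∫⁻ k, u ^ k ∂(L.offspring θ).toMeasure

/-- The moment of order `p` of the normalized offspring distribution. -/
noncomputable def moment (L : Laws Θ) (p : ℝ) (θ : Θ) : ℝ≥0∞ :=
  ∫⁻ k, ((k : ℝ≥0∞) / L.mean θ) ^ p ∂(L.offspring θ).toMeasure

/-- The moment of order `δ` of the normalized immigration distribution. -/
noncomputable def immigrationMoment (L : Laws Θ) (δ : ℝ) (θ : Θ) : ℝ≥0∞ :=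
  ∫⁻ k, ((k : ℝ≥0∞) / L.mean θ) ^ δ ∂(L.immigration θ).toMeasure

@[fun_prop]
lemma measurable_invMean (L : Laws Θ) : Measurable L.invMean :=
  L.measurable_lintegral_offspring _

@[fun_prop]
lemma measurable_moment (L : Laws Θ) (p : ℝ) : Measurable (L.moment p) := by
  have : L.moment p = fun θ => ∑' k : ℕ, ((k : ℝ≥0∞) / L.mean θ) ^ p * L.offspring θ k := by
    funext θ
    rw [moment, lintegral_offspring]
  rw [this]
  refine Measurable.tsum fun k => Measurable.mul ?_ (L.measurable_offspring k)
  fun_prop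

@[fun_prop]
lemma measurable_immigrationMoment (L : Laws Θ) (δ : ℝ) :
    Measurable (L.immigrationMoment δ) := by
  have : L.immigrationMoment δ
      = fun θ => ∑' k : ℕ, ((k : ℝ≥0∞) / L.mean θ) ^ δ * L.immigration θ k := by
    funext θ
    rw [immigrationMoment, lintegral_countable']
    refine tsum_congr fun k => ?_
    rw [PMF.toMeasure_apply_singleton _ _ (measurableSet_singleton k)]
  rw [this]
  refine Measurable.tsum fun k => Measurable.mul ?_ (L.measurable_immigration k)
  fun_prop

lemma quenchedMoment_eq (L : Laws Θ) (p : ℝ) (e : ℕ → Θ) :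
    L.quenchedMoment p e = L.moment p (e 0) :=
  L.lintegral_quenched_offspring e 0 0 fun k => ((k : ℝ≥0∞) / L.mean (e 0)) ^ p

lemma invMean_ne_zero (L : Laws Θ) (θ : Θ) : L.invMean θ ≠ 0 := by
  rw [invMean, lintegral_offspring]
  obtain ⟨k, hk⟩ := (L.offspring θ).support_nonempty
  rw [ne_eq, ENNReal.tsum_eq_zero]
  push Not
  exact ⟨k, mul_ne_zero (by simp) ((L.offspring θ).mem_support_iff k |>.1 hk)⟩

lemma ae_offspring_ne_zero (L : Laws Θ) {θ : Θ} (h : L.offspring θ 0 = 0) :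
    ∀ᵐ k ∂(L.offspring θ).toMeasure, k ≠ 0 := by
  rw [ae_iff]
  simp only [ne_eq, not_not, Set.ofPred_eq_eq_singleton]
  rwa [PMF.toMeasure_apply_singleton _ _ (measurableSet_singleton 0)]

lemma invMean_le_one (L : Laws Θ) {θ : Θ} (h : L.offspring θ 0 = 0) : L.invMean θ ≤ 1 := by
  calc L.invMean θ ≤ ∫⁻ _, 1 ∂(L.offspring θ).toMeasure := by
        refine lintegral_mono_ae ?_
        filter_upwards [L.ae_offspring_ne_zero h] with k hk
        rw [ENNReal.inv_le_one]
        exact_mod_cast hk.bot_lt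
    _ = 1 := by simp

lemma one_le_mean (L : Laws Θ) {θ : Θ} (h : L.offspring θ 0 = 0) : 1 ≤ L.mean θ := by
  calc (1 : ℝ≥0∞) = ∫⁻ _, 1 ∂(L.offspring θ).toMeasure := by simp
    _ ≤ L.mean θ := by
        rw [mean_eq_lintegral]
        refine lintegral_mono_ae ?_
        filter_upwards [L.ae_offspring_ne_zero h] with k hk
        exact_mod_cast hk.bot_lt

/-- The reciprocal of the mean is at most the mean of the reciprocal. -/
lemma inv_mean_le_invMean (L : Laws Θ) {θ : Θ} (h : L.offspring θ 0 = 0) :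
    (L.mean θ)⁻¹ ≤ L.invMean θ := by
  have h1 := L.one_le_mean h
  rcases eq_or_ne (L.mean θ) ∞ with hm | hm
  · simp [hm]
  have hm0 : L.mean θ ≠ 0 := (zero_lt_one.trans_le h1).ne'
  -- Integrating `k / m + m / k ≥ 2` takes the place of Jensen for `1 / x`.
  have key : (2 : ℝ≥0∞) ≤ 1 + L.mean θ * L.invMean θ := by
    calc (2 : ℝ≥0∞) = ∫⁻ _, 2 ∂(L.offspring θ).toMeasure := by simp
      _ ≤ ∫⁻ k, ((k : ℝ≥0∞) * (L.mean θ)⁻¹ + L.mean θ * (k : ℝ≥0∞)⁻¹)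
            ∂(L.offspring θ).toMeasure := by
          refine lintegral_mono_ae ?_
          filter_upwards [L.ae_offspring_ne_zero h] with k hk
          have hk0 : (0 : ℝ) < k := by exact_mod_cast hk.bot_lt
          have hM := ENNReal.toReal_pos hm0 hm
          rw [← ENNReal.ofReal_toReal hm, ← ENNReal.ofReal_natCast,
            ← ENNReal.ofReal_inv_of_pos hM, ← ENNReal.ofReal_inv_of_pos hk0,
            ← ENNReal.ofReal_mul hk0.le, ← ENNReal.ofReal_mul hM.le,
            ← ENNReal.ofReal_add (by positivity) (by positivity),
            show (2 : ℝ≥0∞) = ENNReal.ofReal 2 by simp]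
          refine ENNReal.ofReal_le_ofReal ?_
          rw [← div_eq_mul_inv, ← div_eq_mul_inv, div_add_div _ _ hM.ne' hk0.ne',
            le_div_iff₀ (by positivity)]
          nlinarith [sq_nonneg ((k : ℝ) - (L.mean θ).toReal)]
      _ = 1 + L.mean θ * L.invMean θ := by
          rw [lintegral_add_left (by fun_prop), lintegral_mul_const _ (by fun_prop),
            lintegral_const_mul _ (by fun_prop), ← mean_eq_lintegral, ENNReal.mul_inv_cancel hm0 hm]
          rfl
  rw [show (2 : ℝ≥0∞) = 1 + 1 by norm_num, ENNReal.add_le_add_iff_left (by simp)] at key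
  rw [← one_div]
  exact ENNReal.div_le_of_le_mul' key

/-- The branching property: `popSize n` is a function of the past, so row `n` may be averaged with
the past frozen. The weight `H` serves to restrict to events of the past in the supermartingale
argument. -/
lemma lintegral_offspring_sum (L : Laws Θ) (e : ℕ → Θ) (n : ℕ) (f : ℕ → ℝ≥0∞)
    {H : Path → ℝ≥0∞} (hH : Measurable H) :
    ∫⁻ z, H (past n z) * f (∑ i ∈ Finset.range (popSize n z), z.1 n i) ∂(L.quenched e)
      = ∫⁻ z, H (past n z) * ∫⁻ x, f (∑ i ∈ Finset.range (popSize n z), x i) ∂(L.rowLaw (e n))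
          ∂(L.quenched e) := by
  have hf : Measurable f := measurable_from_top
  have hF : Measurable fun q : Path × (ℕ → ℕ) =>
      f (∑ i ∈ Finset.range (popSize n q.1), q.2 i) :=
    hf.comp (measurable_sum_range (by fun_prop) fun i => by fun_prop)
  have := L.lintegral_past_row e n
    (F := fun w x => H w * f (∑ i ∈ Finset.range (popSize n w), x i))
    ((hH.comp measurable_fst).mul hF)
  simp only [popSize_past le_rfl] at this
  rw [this]
  refine lintegral_congr fun z => ?_
  rw [lintegral_const_mul]
  exact hf.comp (measurable_sum_range measurable_const fun i => measurable_pi_apply i)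

lemma lintegral_rowLaw_inv_le (L : Laws Θ) (θ : Θ) (z : ℕ) :
    ∫⁻ x, ((∑ i ∈ Finset.range z, x i : ℕ) : ℝ≥0∞)⁻¹ ∂(L.rowLaw θ)
      ≤ L.invMean θ * (z : ℝ≥0∞)⁻¹ := by
  rcases eq_or_ne z 0 with rfl | hz
  -- For an empty population the right side is `∞`, because `invMean` never vanishes.
  · simp [ENNReal.mul_top (L.invMean_ne_zero θ)]
  calc _ ≤ ∫⁻ x, (z : ℝ≥0∞)⁻¹ * ((z : ℝ≥0∞)⁻¹ * ∑ i ∈ Finset.range z, (x i : ℝ≥0∞)⁻¹)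
          ∂(L.rowLaw θ) := lintegral_mono fun x => inv_sum_natCast_le hz x
    _ = (z : ℝ≥0∞)⁻¹ * ((z : ℝ≥0∞)⁻¹ * (z * L.invMean θ)) := by
        have hm : ∀ i, Measurable fun x : ℕ → ℕ => (x i : ℝ≥0∞)⁻¹ := fun i => by fun_prop
        have hs : Measurable fun x : ℕ → ℕ => ∑ i ∈ Finset.range z, (x i : ℝ≥0∞)⁻¹ :=
          Finset.measurable_sum _ fun i _ => hm i
        rw [lintegral_const_mul _ (by fun_prop), lintegral_const_mul _ (by fun_prop),
          lintegral_finsetSum _ fun i _ => hm i,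
          Finset.sum_congr rfl fun i _ => L.lintegral_rowLaw_eval θ i fun k => (k : ℝ≥0∞)⁻¹]
        simp [invMean]
    _ = L.invMean θ * (z : ℝ≥0∞)⁻¹ := by
        rw [← mul_assoc (z : ℝ≥0∞)⁻¹ (z : ℝ≥0∞), ENNReal.inv_mul_cancel (by simpa using hz)
          (by simp), one_mul, mul_comm]

/-- Immigration only lowers `1 / Z`, so it is dropped, and each generation contributes one factor
`invMean`. -/
lemma lintegral_inv_popSize_le (L : Laws Θ) (e : ℕ → Θ) (n : ℕ) :
    ∫⁻ z, (popSize n z : ℝ≥0∞)⁻¹ ∂(L.quenched e) ≤ ∏ i ∈ Finset.range n, L.invMean (e i) := by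
  induction n with
  | zero => simp
  | succ n ih =>
    calc ∫⁻ z, (popSize (n + 1) z : ℝ≥0∞)⁻¹ ∂(L.quenched e)
        ≤ ∫⁻ z, 1 * ((∑ i ∈ Finset.range (popSize n z), z.1 n i : ℕ) : ℝ≥0∞)⁻¹
            ∂(L.quenched e) := by
          refine lintegral_mono fun z => ?_
          rw [one_mul, ENNReal.inv_le_inv, popSize_succ]
          exact_mod_cast Nat.le_add_left _ _
      _ ≤ ∫⁻ z, L.invMean (e n) * (popSize n z : ℝ≥0∞)⁻¹ ∂(L.quenched e) := by
          rw [L.lintegral_offspring_sum e n (fun k => (k : ℝ≥0∞)⁻¹) (H := fun _ => 1)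
            measurable_const]
          simp only [one_mul]
          exact lintegral_mono fun z => L.lintegral_rowLaw_inv_le (e n) (popSize n z)
      _ = L.invMean (e n) * ∫⁻ z, (popSize n z : ℝ≥0∞)⁻¹ ∂(L.quenched e) :=
          lintegral_const_mul _ (by fun_prop)
      _ ≤ _ := by
          rw [Finset.prod_range_succ, mul_comm]
          gcongr

lemma lintegral_rowLaw_rpow_le (L : Laws Θ) (θ : Θ) (z : ℕ) {δ : ℝ} (h0 : 0 < δ) (h1 : δ ≤ 1) :
    ∫⁻ x, ((∑ i ∈ Finset.range z, x i : ℕ) : ℝ≥0∞) ^ δ ∂(L.rowLaw θ)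
      ≤ L.mean θ ^ δ * (z : ℝ≥0∞) ^ δ := by
  have hs : Measurable fun x : ℕ → ℕ => ((∑ i ∈ Finset.range z, x i : ℕ) : ℝ≥0∞) :=
    measurable_from_top.comp (measurable_sum_range measurable_const fun i => measurable_pi_apply i)
  refine (lintegral_rpow_le_rpow_lintegral hs.aemeasurable h0 h1).trans (le_of_eq ?_)
  push_cast
  rw [lintegral_finsetSum _ fun i _ => by fun_prop,
    Finset.sum_congr rfl fun i _ => L.lintegral_rowLaw_eval θ i fun k => (k : ℝ≥0∞)]
  simp [← mean_eq_lintegral, ENNReal.mul_rpow_of_nonneg _ _ h0.le, mul_comm]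

/-- Given the past, the offspring total of generation `n` has generating function `pgf ^ popSize n`;
the immigrants can be dropped because `u ≤ 1`. -/
lemma lintegral_pow_popSize_succ_le (L : Laws Θ) (e : ℕ → Θ) (n : ℕ) {u : ℝ≥0∞} (hu : u ≤ 1) :
    ∫⁻ z, u ^ popSize (n + 1) z ∂(L.quenched e)
      ≤ ∫⁻ z, L.pgf (e n) u ^ popSize n z ∂(L.quenched e) := by
  calc ∫⁻ z, u ^ popSize (n + 1) z ∂(L.quenched e)
      ≤ ∫⁻ z, 1 * u ^ (∑ i ∈ Finset.range (popSize n z), z.1 n i) ∂(L.quenched e) := by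
        refine lintegral_mono fun z => ?_
        rw [one_mul, popSize_succ]
        exact pow_le_pow_right_of_le_one' hu (Nat.le_add_left _ _)
    _ = _ := by
        rw [L.lintegral_offspring_sum e n (fun k => u ^ k) (H := fun _ => 1) measurable_const]
        refine lintegral_congr fun z => ?_
        simp only [one_mul, ← Finset.prod_pow_eq_pow_sum]
        rw [L.lintegral_rowLaw_prod (e n) _ fun k => u ^ k, Finset.card_range]
        rfl

end Laws

/-! ### The lower tail through generating functions -/

/-- If `k x ≥ 1`, then `(1 - x) ^ k ≤ 1` and `k x ≤ (k x) ^ p`. If `k x ≤ 1`, then `(1 - x) ^ k ≤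
exp (-k x) ≤ 1 - k x + (k x) ^ 2`, and the square is at most the power `p` because `p ≤ 2`. -/
lemma one_sub_pow_add_le {x p : ℝ} (hx0 : 0 ≤ x) (hx1 : x ≤ 1) (hp1 : 1 ≤ p) (hp2 : p ≤ 2)
    (k : ℕ) : (1 - x) ^ k + k * x ≤ 1 + (k * x) ^ p := by
  rcases le_total 1 (k * x) with h | h
  · have h1 : (1 - x) ^ k ≤ 1 := pow_le_one₀ (by linarith) (by linarith)
    have h2 := Real.rpow_le_rpow_of_exponent_le h hp1
    rw [Real.rpow_one] at h2
    linarith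
  · have h0 : 0 ≤ k * x := by positivity
    have h1 : (1 - x) ^ k ≤ Real.exp (-(k * x)) := by
      rw [show -(k * x) = k * (-x) by ring, Real.exp_nat_mul]
      exact pow_le_pow_left₀ (by linarith) (Real.one_sub_le_exp_neg x) k
    have h2 := Real.abs_exp_sub_one_sub_id_le (x := -(k * x)) (by rwa [abs_neg, abs_of_nonneg h0])
    have h3 := (abs_le.1 h2).2
    have h4 : (k * x) ^ (2 : ℝ) ≤ (k * x) ^ p := by
      rcases h0.eq_or_lt with h0 | h0
      · rw [← h0, Real.zero_rpow (by norm_num), Real.zero_rpow (by linarith)]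
      · exact Real.rpow_le_rpow_of_exponent_ge h0 h hp2
    rw [Real.rpow_two] at h4
    nlinarith

namespace Laws

/-- The preceding pointwise inequality is integrated over the offspring number, with `k x` written
as `(m x) (k / m)` to bring out the normalized moment. -/
lemma pgf_le (L : Laws Θ) {θ : Θ} (h0 : L.offspring θ 0 = 0) (hm : L.mean θ ≠ ∞)
    {p : ℝ} (hp1 : 1 ≤ p) (hp2 : p ≤ 2) (hmu : L.moment p θ ≠ ∞) {x : ℝ} (hx0 : 0 ≤ x)
    (hx1 : x ≤ 1) :
    L.pgf θ (ENNReal.ofReal (1 - x)) ≤ ENNReal.ofReal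
      (1 - (L.mean θ).toReal * x + ((L.mean θ).toReal * x) ^ p * (L.moment p θ).toReal) := by
  have hmean0 : L.mean θ ≠ 0 := (zero_lt_one.trans_le (L.one_le_mean h0)).ne'
  set M := (L.mean θ).toReal with hM
  have hMpos : 0 < M := ENNReal.toReal_pos hmean0 hm
  have hME : L.mean θ = ENNReal.ofReal M := (ENNReal.ofReal_toReal hm).symm
  -- The additive form avoids truncated subtraction; once all terms are known to be finite, it is
  -- read in the reals.
  have key : L.pgf θ (ENNReal.ofReal (1 - x)) + ENNReal.ofReal (M * x)
      ≤ 1 + ENNReal.ofReal ((M * x) ^ p) * L.moment p θ := by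
    calc _ = ∫⁻ k, (ENNReal.ofReal (1 - x) ^ k + k * ENNReal.ofReal x)
            ∂(L.offspring θ).toMeasure := by
          rw [lintegral_add_left (by fun_prop), lintegral_mul_const _ (by fun_prop),
            ← mean_eq_lintegral, hME, ENNReal.ofReal_mul hMpos.le]
          rfl
      _ ≤ ∫⁻ k, (1 + ENNReal.ofReal ((M * x) ^ p) * ((k : ℝ≥0∞) / L.mean θ) ^ p)
            ∂(L.offspring θ).toMeasure := by
          refine lintegral_mono fun k => ?_
          have e1 : (k : ℝ≥0∞) / L.mean θ = ENNReal.ofReal (k / M) := by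
            rw [hME, ENNReal.ofReal_div_of_pos hMpos, ENNReal.ofReal_natCast]
          rw [e1, ENNReal.ofReal_rpow_of_nonneg (by positivity) (by linarith),
            ← ENNReal.ofReal_mul (by positivity), ← ENNReal.ofReal_pow (by linarith),
            ← ENNReal.ofReal_natCast, ← ENNReal.ofReal_mul (by positivity),
            ← ENNReal.ofReal_add (pow_nonneg (by linarith) _) (by positivity),
            ← ENNReal.ofReal_one, ← ENNReal.ofReal_add (by norm_num) (by positivity)]
          refine ENNReal.ofReal_le_ofReal ?_
          rw [← Real.mul_rpow (by positivity) (by positivity),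
            show M * x * (k / M) = k * x by field_simp]
          exact one_sub_pow_add_le hx0 hx1 hp1 hp2 k
      _ = _ := by
          rw [lintegral_add_left (by fun_prop), lintegral_const_mul _ (by fun_prop)]
          simp [moment]
  have hp_top : L.pgf θ (ENNReal.ofReal (1 - x)) ≠ ∞ :=
    ne_top_of_le_ne_top (by finiteness) (le_self_add.trans key)
  rw [← ENNReal.ofReal_toReal hmu, ← ENNReal.ofReal_mul (by positivity), ← ENNReal.ofReal_one,
    ← ENNReal.ofReal_add (by norm_num) (by positivity), ← ENNReal.ofReal_toReal hp_top,
    ← ENNReal.ofReal_add (by positivity) (by positivity),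
    ENNReal.ofReal_le_ofReal_iff (by positivity)] at key
  rw [← ENNReal.ofReal_toReal hp_top]
  refine ENNReal.ofReal_le_ofReal ?_
  linarith


/-- The product of the mean offspring numbers of the generations `j, …, n - 1`. -/
noncomputable def meanProd (L : Laws Θ) (e : ℕ → Θ) (j n : ℕ) : ℝ :=
  ∏ l ∈ Finset.Ico j n, (L.mean (e l)).toReal

/-- The sum of the normalized moments of the generations `j, …, n - 1`, discounted. -/
noncomputable def discountedMoment (L : Laws Θ) (p : ℝ) (e : ℕ → Θ) (j n : ℕ) : ℝ :=
  ∑ k ∈ Finset.Ico j n, (L.moment p (e k)).toReal * L.meanProd e j k ^ (-(p - 1))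

/-- In the state `θ` an individual has at least one child, the mean offspring number is finite
and so is the moment of order `p`. -/
structure Regular (L : Laws Θ) (p : ℝ) (θ : Θ) : Prop where
  offspring_zero : L.offspring θ 0 = 0
  mean_ne_top : L.mean θ ≠ ∞
  moment_ne_top : L.moment p θ ≠ ∞

lemma Regular.one_le_toReal_mean {L : Laws Θ} {p : ℝ} {θ : Θ} (h : L.Regular p θ) :
    1 ≤ (L.mean θ).toReal := by
  rw [← ENNReal.toReal_one]
  exact ENNReal.toReal_mono h.mean_ne_top (L.one_le_mean h.offspring_zero)

variable {L : Laws Θ} {p : ℝ} {e : ℕ → Θ}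

lemma one_le_meanProd (he : ∀ k, L.Regular p (e k)) (j n : ℕ) : 1 ≤ L.meanProd e j n :=
  Finset.prod_induction _ (1 ≤ ·) (fun _ _ => one_le_mul_of_one_le_of_one_le) le_rfl
    fun l _ => (he l).one_le_toReal_mean

lemma meanProd_succ (L : Laws Θ) (e : ℕ → Θ) {j n : ℕ} (h : j ≤ n) :
    L.meanProd e j (n + 1) = L.meanProd e j n * (L.mean (e n)).toReal :=
  Finset.prod_Ico_succ_top h _

lemma discountedMoment_nonneg (he : ∀ k, L.Regular p (e k)) (j n : ℕ) :
    0 ≤ L.discountedMoment p e j n :=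
  Finset.sum_nonneg fun k _ => mul_nonneg ENNReal.toReal_nonneg
    (Real.rpow_nonneg (zero_le_one.trans (one_le_meanProd he j k)) _)

/-- Generations are removed one at a time from `n` down to `j` by `pgf_le`. The main term turns the
normalization at `k + 1` into the one at `k`; the error terms together cost at most half of `s`. -/
lemma lintegral_pow_popSize_le (he : ∀ k, L.Regular p (e k)) (hp1 : 1 < p) (hp2 : p ≤ 2)
    {j n : ℕ} (hjn : j ≤ n) {s : ℝ} (hs0 : 0 < s) (hs1 : s ≤ 1)
    (hs : s ^ (p - 1) * L.discountedMoment p e j n ≤ 1 / 2) :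
    ∫⁻ z, ENNReal.ofReal (1 - s / L.meanProd e j n) ^ popSize n z ∂(L.quenched e)
      ≤ ∫⁻ z, ENNReal.ofReal (1 - s / 2) ^ popSize j z ∂(L.quenched e) := by
  set c : ℕ → ℝ := fun i => (L.moment p (e i)).toReal * L.meanProd e j i ^ (-(p - 1)) with hc
  -- The argument left at time `k`: `y n = s` and `y k = y (k + 1) - s ^ p * c k`. Measuring each
  -- error with `s` instead of the smaller `y (k + 1)` makes the recursion explicit.
  set y : ℕ → ℝ := fun k => s - s ^ p * ∑ i ∈ Finset.Ico k n, c i with hy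
  have hR : ∀ k, 1 ≤ L.meanProd e j k := fun k => one_le_meanProd he j k
  have hc0 : ∀ i, 0 ≤ c i := fun i => mul_nonneg ENNReal.toReal_nonneg
    (Real.rpow_nonneg (zero_le_one.trans (hR i)) _)
  have hsp : s ^ p = s * s ^ (p - 1) := by
    rw [Real.rpow_sub hs0, Real.rpow_one]; field_simp
  have hyle : ∀ k, y k ≤ s := fun k =>
    sub_le_self _ (mul_nonneg (Real.rpow_nonneg hs0.le _) (Finset.sum_nonneg fun i _ => hc0 i))
  have hyge : ∀ k, j ≤ k → s / 2 ≤ y k := fun k hk => by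
    have h1 : ∑ i ∈ Finset.Ico k n, c i ≤ L.discountedMoment p e j n :=
      Finset.sum_le_sum_of_subset_of_nonneg (Finset.Ico_subset_Ico_left hk) fun i _ _ => hc0 i
    have h2 : s ^ p * ∑ i ∈ Finset.Ico k n, c i ≤ s * (1 / 2) := by
      calc _ ≤ s ^ p * L.discountedMoment p e j n := by gcongr
        _ = s * (s ^ (p - 1) * L.discountedMoment p e j n) := by rw [hsp]; ring
        _ ≤ _ := by gcongr
    simp only [hy]
    linarith
  have main : ∀ k, k ≤ n → j ≤ k →
      ∫⁻ z, ENNReal.ofReal (1 - s / L.meanProd e j n) ^ popSize n z ∂(L.quenched e)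
        ≤ ∫⁻ z, ENNReal.ofReal (1 - y k / L.meanProd e j k) ^ popSize k z ∂(L.quenched e) := by
    intro k hkn
    induction hkn using Nat.decreasingInduction with
    | self => intro _; simp [hy]
    | of_succ k hkn ih =>
      intro hjk
      refine (ih (by omega)).trans ?_
      have hy0 : 0 ≤ y (k + 1) := (by positivity : 0 ≤ s / 2).trans (hyge (k + 1) (by omega))
      have hRk := hR k
      have hRk1 := hR (k + 1)
      have hM := (he k).one_le_toReal_mean
      refine (L.lintegral_pow_popSize_succ_le e k (ENNReal.ofReal_le_one.2
        (sub_le_self _ (by positivity)))).trans (lintegral_mono fun z => ?_)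
      refine pow_le_pow_left' ?_ _
      refine (L.pgf_le (he k).offspring_zero (he k).mean_ne_top hp1.le hp2
        (he k).moment_ne_top (by positivity)
        (div_le_one_of_le₀ (((hyle _).trans hs1).trans hRk1) (by positivity))).trans ?_
      refine ENNReal.ofReal_le_ofReal ?_
      have e1 : (L.mean (e k)).toReal * (y (k + 1) / L.meanProd e j (k + 1))
          = y (k + 1) / L.meanProd e j k := by
        rw [L.meanProd_succ e hjk]; field_simp
      have e2 : y k = y (k + 1) - s ^ p * c k := by
        simp only [hy]
        rw [← Finset.sum_Ioo_add_eq_sum_Ico hkn,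
          show Finset.Ioo k n = Finset.Ico (k + 1) n by ext; simp]
        ring
      have hRpos : 0 < L.meanProd e j k := by positivity
      have e3 : s ^ p * c k / L.meanProd e j k
          = (s / L.meanProd e j k) ^ p * (L.moment p (e k)).toReal := by
        rw [Real.div_rpow hs0.le hRpos.le]
        simp only [hc]
        rw [Real.rpow_neg hRpos.le, Real.rpow_sub hRpos, Real.rpow_one]
        field_simp
      have e4 : (y (k + 1) / L.meanProd e j k) ^ p * (L.moment p (e k)).toReal
          ≤ (s / L.meanProd e j k) ^ p * (L.moment p (e k)).toReal := by
        have := hyle (k + 1)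
        gcongr
      rw [e1, e2, sub_div (y (k + 1)), e3]
      linarith
  refine (main j hjn le_rfl).trans (lintegral_mono fun z => pow_le_pow_left' ?_ _)
  refine ENNReal.ofReal_le_ofReal ?_
  have := hyge j le_rfl
  simp [meanProd]
  linarith

/-- `(1 - t) ^ k ≤ exp (-k t)`, while `(k t) ^ κ ≤ 1 + k t ≤ exp (k t)` for `κ ≤ 1`. At `k = 0` the
right side is `∞`. -/
lemma ofReal_one_sub_pow_le {t κ : ℝ} (ht0 : 0 < t) (ht1 : t ≤ 1) (hκ0 : 0 < κ) (hκ1 : κ ≤ 1)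
    (k : ℕ) :
    ENNReal.ofReal (1 - t) ^ k ≤ ENNReal.ofReal (t⁻¹) ^ κ * ((k : ℝ≥0∞)⁻¹) ^ κ := by
  rcases Nat.eq_zero_or_pos k with rfl | hk
  · have : ENNReal.ofReal (t⁻¹) ^ κ ≠ 0 :=
      (ENNReal.rpow_pos (ENNReal.ofReal_pos.2 (by positivity)) (by finiteness)).ne'
    simp [hκ0, ENNReal.mul_top this]
  have hk' : (0 : ℝ) < k := by exact_mod_cast hk
  rw [← ENNReal.ofReal_natCast, ← ENNReal.ofReal_inv_of_pos hk',
    ENNReal.ofReal_rpow_of_nonneg (by positivity) hκ0.le,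
    ENNReal.ofReal_rpow_of_nonneg (by positivity) hκ0.le, ← ENNReal.ofReal_mul (by positivity),
    ← ENNReal.ofReal_pow (by linarith), ← Real.mul_rpow (by positivity) (by positivity),
    ← mul_inv, Real.inv_rpow (by positivity)]
  refine ENNReal.ofReal_le_ofReal ?_
  have h1 : (1 - t) ^ k ≤ Real.exp (-(k * t)) := by
    rw [show -(k * t) = k * (-t) by ring, Real.exp_nat_mul]
    exact pow_le_pow_left₀ (by linarith) (Real.one_sub_le_exp_neg t) k
  refine h1.trans ?_
  rw [Real.exp_neg]
  refine inv_anti₀ (by positivity) ?_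
  have h2 : (t * k) ^ κ ≤ (t * k + 1) ^ (1 : ℝ) := by
    calc (t * k) ^ κ ≤ (t * k + 1) ^ κ :=
          Real.rpow_le_rpow (by positivity) (by linarith) hκ0.le
      _ ≤ _ := Real.rpow_le_rpow_of_exponent_le (by linarith [mul_pos ht0 hk']) hκ1
  rw [Real.rpow_one] at h2
  have := Real.add_one_le_exp (k * t)
  linarith

lemma exp_neg_two_mul_le {x : ℝ} (h0 : 0 ≤ x) (h1 : x ≤ 1 / 2) : Real.exp (-(2 * x)) ≤ 1 - x := by
  rw [Real.exp_neg, inv_le_comm₀ (Real.exp_pos _) (by linarith)]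
  refine le_trans ?_ (Real.add_one_le_exp _)
  rw [inv_le_iff_one_le_mul₀ (by linarith)]
  nlinarith

/-- The lower tail of the population size, given the environment. -/
lemma quenched_popSize_lt_le (he : ∀ k, L.Regular p (e k)) (hp1 : 1 < p) (hp2 : p ≤ 2)
    {j n : ℕ} (hjn : j ≤ n) {κ : ℝ} (hκ0 : 0 < κ) (hκ1 : κ ≤ 1) {s : ℝ} (hs0 : 0 < s)
    (hs1 : s ≤ 1 / 2) (hs : s ^ (p - 1) * L.discountedMoment p e j n ≤ 1 / 2) :
    L.quenched e {z | (popSize n z : ℝ) < L.meanProd e j n}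
      ≤ ENNReal.ofReal (Real.exp 1) * (ENNReal.ofReal ((s / 2)⁻¹) ^ κ
        * (∏ i ∈ Finset.range j, L.invMean (e i)) ^ κ) := by
  set R := L.meanProd e j n
  have hR : 1 ≤ R := one_le_meanProd he j n
  have hRpos : 0 < R := by positivity
  have hsR : s / R ≤ 1 / 2 := by
    rw [div_le_iff₀ hRpos]; nlinarith
  -- Markov's inequality: where `Z_n < R`, the power `(1 - s / R) ^ Z_n` is at least `exp (-2 s) ≥
  -- exp (-1)`, as `s ≤ 1 / 2`.
  have h1 : ∀ z ∈ {z : Path | (popSize n z : ℝ) < R},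
      1 ≤ ENNReal.ofReal (Real.exp 1) * ENNReal.ofReal (1 - s / R) ^ popSize n z := by
    intro z hz
    have hz : (popSize n z : ℝ) < R := hz
    rw [← ENNReal.ofReal_pow (by linarith), ← ENNReal.ofReal_mul (Real.exp_nonneg 1),
      ENNReal.one_le_ofReal]
    calc (1 : ℝ) ≤ Real.exp (1 + popSize n z * (-(2 * (s / R)))) := by
          refine Real.one_le_exp ?_
          have : (popSize n z : ℝ) * (s / R) ≤ s := by
            calc _ ≤ R * (s / R) := by gcongr
              _ = s := by field_simp
          linarith
      _ ≤ _ := by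
          rw [Real.exp_add, Real.exp_nat_mul]
          gcongr
          exact exp_neg_two_mul_le (by positivity) hsR
  have hms : MeasurableSet {z : Path | (popSize n z : ℝ) < R} :=
    measurableSet_lt (by fun_prop) measurable_const
  calc L.quenched e {z | (popSize n z : ℝ) < R}
      = ∫⁻ z in {z | (popSize n z : ℝ) < R}, 1 ∂(L.quenched e) := by simp
    _ ≤ ∫⁻ z in {z | (popSize n z : ℝ) < R},
          ENNReal.ofReal (Real.exp 1) * ENNReal.ofReal (1 - s / R) ^ popSize n z
            ∂(L.quenched e) := setLIntegral_mono' hms h1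
    _ ≤ ∫⁻ z, ENNReal.ofReal (Real.exp 1) * ENNReal.ofReal (1 - s / R) ^ popSize n z
            ∂(L.quenched e) := setLIntegral_le_lintegral _ _
    _ = ENNReal.ofReal (Real.exp 1) * ∫⁻ z, ENNReal.ofReal (1 - s / R) ^ popSize n z
            ∂(L.quenched e) := lintegral_const_mul _ (by fun_prop)
    _ ≤ _ := by
        gcongr
        refine (lintegral_pow_popSize_le he hp1 hp2 hjn hs0 (by linarith) hs).trans ?_
        calc _ ≤ ∫⁻ z, ENNReal.ofReal ((s / 2)⁻¹) ^ κ * ((popSize j z : ℝ≥0∞)⁻¹) ^ κ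
                ∂(L.quenched e) := lintegral_mono fun z =>
                  ofReal_one_sub_pow_le (by positivity) (by linarith) hκ0 hκ1 _
          _ = ENNReal.ofReal ((s / 2)⁻¹) ^ κ * ∫⁻ z, ((popSize j z : ℝ≥0∞)⁻¹) ^ κ
                ∂(L.quenched e) := lintegral_const_mul _ (by fun_prop)
          _ ≤ _ := by
              gcongr
              refine (lintegral_rpow_le_rpow_lintegral (by fun_prop) hκ0 hκ1).trans ?_
              gcongr
              exact L.lintegral_inv_popSize_le e j

end Laws

/-! ### The lower tail of the normalized size -/

lemma sum_rpow_le_sum_rpow {ι : Type*} (s : Finset ι) (f : ι → ℝ≥0∞) {ε : ℝ} (h0 : 0 < ε)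
    (h1 : ε ≤ 1) : (∑ i ∈ s, f i) ^ ε ≤ ∑ i ∈ s, f i ^ ε :=
  Finset.le_sum_of_subadditive (fun x : ℝ≥0∞ => x ^ ε) (by simp [h0])
    (fun x y => ENNReal.rpow_add_le_add_rpow x y h0.le h1) s f

namespace Laws

/-- The population size divided by its mean growth, as a function of the environment and of the
numbers of offspring and immigrants. -/
noncomputable def normalized (L : Laws Θ) (n : ℕ) (q : (ℕ → Θ) × Path) : ℝ≥0∞ :=
  (popSize n q.2 : ℝ≥0∞) / ∏ k ∈ Finset.range n, L.mean (q.1 k)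

@[fun_prop]
lemma measurable_normalized (L : Laws Θ) (n : ℕ) : Measurable (L.normalized n) := by
  unfold normalized
  refine Measurable.div (by fun_prop) (Finset.measurable_prod _ fun k _ => by fun_prop)

variable {L : Laws Θ} {p : ℝ} {e : ℕ → Θ}

lemma prod_mean_ne_zero (he : ∀ k, L.Regular p (e k)) (s : Finset ℕ) :
    ∏ k ∈ s, L.mean (e k) ≠ 0 :=
  Finset.prod_ne_zero_iff.2 fun k _ =>
    (zero_lt_one.trans_le (L.one_le_mean (he k).offspring_zero)).ne'

lemma prod_mean_ne_top (he : ∀ k, L.Regular p (e k)) (s : Finset ℕ) :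
    ∏ k ∈ s, L.mean (e k) ≠ ∞ :=
  ENNReal.prod_ne_top fun k _ => (he k).mean_ne_top

lemma inv_prod_mean_le (he : ∀ k, L.Regular p (e k)) (s : Finset ℕ) :
    (∏ k ∈ s, L.mean (e k))⁻¹ ≤ ∏ k ∈ s, L.invMean (e k) := by
  rw [ENNReal.prod_inv_distrib fun i _ j _ _ => Or.inr (he j).mean_ne_top]
  exact Finset.prod_le_prod' fun k _ => L.inv_mean_le_invMean (he k).offspring_zero

lemma ofReal_meanProd (he : ∀ k, L.Regular p (e k)) (j n : ℕ) :
    ENNReal.ofReal (L.meanProd e j n) = ∏ l ∈ Finset.Ico j n, L.mean (e l) := by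
  rw [meanProd, ENNReal.ofReal_prod_of_nonneg fun _ _ => ENNReal.toReal_nonneg]
  exact Finset.prod_congr rfl fun l _ => ENNReal.ofReal_toReal (he l).mean_ne_top

lemma normalized_lt_inv_iff (he : ∀ k, L.Regular p (e k)) {j n : ℕ} (hjn : j ≤ n) (z : Path) :
    L.normalized n (e, z) < (∏ k ∈ Finset.range j, L.mean (e k))⁻¹
      ↔ (popSize n z : ℝ) < L.meanProd e j n := by
  have h0 := prod_mean_ne_zero he (Finset.range j)
  have h1 := prod_mean_ne_top he (Finset.range j)
  rw [← ENNReal.ofReal_lt_ofReal_iff (zero_lt_one.trans_le (one_le_meanProd he j n)),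
    ofReal_meanProd he, ENNReal.ofReal_natCast, normalized,
    ENNReal.div_lt_iff (Or.inl (prod_mean_ne_zero he _)) (Or.inl (prod_mean_ne_top he _)),
    ← Finset.prod_range_mul_prod_Ico _ hjn, ← mul_assoc, ENNReal.inv_mul_cancel h0 h1, one_mul]

/-- Subadditivity of `x ^ ε` moves the power inside the sum, and `1 / mean ≤ invMean` makes each
term a product over distinct states, ready for averaging. -/
lemma ofReal_discountedMoment_rpow_le (he : ∀ k, L.Regular p (e k)) (hp1 : 1 < p) {ε : ℝ}
    (hε0 : 0 < ε) (hε1 : ε ≤ 1) (j n : ℕ) :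
    ENNReal.ofReal (L.discountedMoment p e j n) ^ ε ≤ ∑ k ∈ Finset.Ico j n,
      L.moment p (e k) ^ ε * ∏ l ∈ Finset.Ico j k, L.invMean (e l) ^ ((p - 1) * ε) := by
  have hR : ∀ k, 0 < L.meanProd e j k := fun k => zero_lt_one.trans_le (one_le_meanProd he j k)
  rw [discountedMoment, ENNReal.ofReal_sum_of_nonneg fun k _ =>
    mul_nonneg ENNReal.toReal_nonneg (Real.rpow_nonneg (hR k).le _)]
  refine (sum_rpow_le_sum_rpow _ _ hε0 hε1).trans (Finset.sum_le_sum fun k _ => ?_)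
  rw [ENNReal.ofReal_mul ENNReal.toReal_nonneg, ENNReal.ofReal_toReal (he k).moment_ne_top,
    ENNReal.mul_rpow_of_nonneg _ _ hε0.le, ENNReal.prod_rpow_of_nonneg (by nlinarith),
    ← ENNReal.ofReal_rpow_of_pos (hR k), ENNReal.rpow_neg, ← ENNReal.inv_rpow,
    ← ENNReal.rpow_mul, ofReal_meanProd he]
  gcongr
  exact inv_prod_mean_le he _

/-- The lower tail of the normalized population size, given the environment. -/
lemma quenched_normalized_lt_le (he : ∀ k, L.Regular p (e k)) (hp1 : 1 < p) (hp2 : p ≤ 2)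
    {ε : ℝ} (hε0 : 0 < ε) (hε1 : ε ≤ 1) {j n : ℕ} (hjn : j ≤ n) :
    L.quenched e {z | L.normalized n (e, z) < (∏ k ∈ Finset.range j, L.mean (e k))⁻¹}
      ≤ ENNReal.ofReal (4 * Real.exp 1) *
        (∏ i ∈ Finset.range j, L.invMean (e i) ^ ((p - 1) * ε)
          + ∑ k ∈ Finset.Ico j n, (∏ i ∈ Finset.range k, L.invMean (e i) ^ ((p - 1) * ε))
              * L.moment p (e k) ^ ε) := by
  set κ := (p - 1) * ε with hκ
  set A := L.discountedMoment p e j n with hA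
  have hA0 : 0 ≤ A := discountedMoment_nonneg he j n
  have hκ0 : 0 < κ := mul_pos (by linarith) hε0
  have hκ1 : κ ≤ 1 := by nlinarith
  have hp0 : 0 < p - 1 := by linarith
  -- Then `s ^ (p - 1) * A = A / (2 + 2 A) ≤ 1 / 2`, and `s ≤ 1 / 2` because `p ≤ 2`. With `κ = (p -
  -- 1) ε`, the loss `s ^ (-κ)` is `(2 + 2 A) ^ ε`, exactly the power of the moments that the
  -- hypotheses control.
  set s := (2 + 2 * A) ^ (-(p - 1)⁻¹) with hs
  have hB : 0 < 2 + 2 * A := by positivity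
  have hs0 : 0 < s := Real.rpow_pos_of_pos hB _
  have hs1 : s ≤ 1 / 2 := by
    calc s ≤ (2 + 2 * A) ^ (-1 : ℝ) := by
          refine Real.rpow_le_rpow_of_exponent_le (by linarith) (neg_le_neg ?_)
          exact (one_le_inv₀ hp0).2 (by linarith)
      _ ≤ 1 / 2 := by
          rw [Real.rpow_neg_one, inv_eq_one_div]
          exact one_div_le_one_div_of_le (by norm_num) (by linarith)
  have hs2 : s ^ (p - 1) * A ≤ 1 / 2 := by
    rw [hs, ← Real.rpow_mul hB.le, neg_mul, inv_mul_cancel₀ hp0.ne', Real.rpow_neg_one,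
      inv_mul_le_iff₀ hB]
    linarith
  have h1 := quenched_popSize_lt_le he hp1 hp2 hjn hκ0 hκ1 hs0 hs1 hs2
  simp only [normalized_lt_inv_iff he hjn]
  refine h1.trans ?_
  have h2 : ENNReal.ofReal ((s / 2)⁻¹) ^ κ ≤ 4 * (1 + ENNReal.ofReal A ^ ε) := by
    have e1 : ((s / 2)⁻¹) ^ κ = 2 ^ κ * (2 ^ ε * (1 + A) ^ ε) := by
      rw [inv_div, Real.div_rpow (by norm_num) hs0.le, hs, ← Real.rpow_mul hB.le, hκ,
        neg_mul, inv_mul_cancel_left₀ hp0.ne', Real.rpow_neg hB.le, div_inv_eq_mul,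
        show 2 + 2 * A = 2 * (1 + A) by ring, Real.mul_rpow (by norm_num) (by positivity)]
    have e2 : (2 : ℝ) ^ κ ≤ 2 := by
      simpa using Real.rpow_le_rpow_of_exponent_le (by norm_num : (1 : ℝ) ≤ 2) hκ1
    have e3 : (2 : ℝ) ^ ε ≤ 2 := by
      simpa using Real.rpow_le_rpow_of_exponent_le (by norm_num : (1 : ℝ) ≤ 2) hε1
    have e4 : (1 + A) ^ ε ≤ 1 + A ^ ε := by
      simpa using Real.rpow_add_le_add_rpow zero_le_one hA0 hε0.le hε1
    have hAε : 0 ≤ A ^ ε := by positivity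
    rw [ENNReal.ofReal_rpow_of_nonneg (by positivity) hκ0.le,
      ENNReal.ofReal_rpow_of_nonneg hA0 hε0.le, e1, ← ENNReal.ofReal_one,
      ← ENNReal.ofReal_add (by norm_num) hAε,
      show (4 : ℝ≥0∞) = ENNReal.ofReal 4 by simp, ← ENNReal.ofReal_mul (by norm_num)]
    refine ENNReal.ofReal_le_ofReal ?_
    calc (2 : ℝ) ^ κ * (2 ^ ε * (1 + A) ^ ε) ≤ 2 * (2 * (1 + A ^ ε)) := by gcongr
      _ = _ := by ring
  calc _ ≤ ENNReal.ofReal (Real.exp 1) * (4 * (1 + ∑ k ∈ Finset.Ico j n,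
            L.moment p (e k) ^ ε * ∏ l ∈ Finset.Ico j k, L.invMean (e l) ^ κ)
          * ∏ i ∈ Finset.range j, L.invMean (e i) ^ κ) := by
        rw [← ENNReal.prod_rpow_of_nonneg (s := Finset.range j) hκ0.le]
        gcongr
        refine h2.trans ?_
        gcongr
        exact ofReal_discountedMoment_rpow_le he hp1 hε0 hε1 j n
    _ = ENNReal.ofReal (4 * Real.exp 1) * ((1 + ∑ k ∈ Finset.Ico j n,
            L.moment p (e k) ^ ε * ∏ l ∈ Finset.Ico j k, L.invMean (e l) ^ κ)
          * ∏ i ∈ Finset.range j, L.invMean (e i) ^ κ) := by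
        rw [ENNReal.ofReal_mul (by norm_num), ENNReal.ofReal_ofNat]
        ring
    _ = _ := by
        rw [add_mul, one_mul, Finset.sum_mul]
        congr 2
        refine Finset.sum_congr rfl fun k hk => ?_
        rw [← Finset.prod_range_mul_prod_Ico _ (Finset.mem_Ico.1 hk).1]
        ring

/-! ### Fractional moments of the normalized size -/

/-- The contribution of the immigrants of generation `n` to the normalized population size. -/
noncomputable def normalizedImmigration (L : Laws Θ) (n : ℕ) (q : (ℕ → Θ) × Path) : ℝ≥0∞ :=
  (q.2.2 n : ℝ≥0∞) / ∏ k ∈ Finset.range (n + 1), L.mean (q.1 k)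

/-- The contribution of the offspring of generation `n` to the normalized population size. -/
noncomputable def normalizedOffspring (L : Laws Θ) (n : ℕ) (q : (ℕ → Θ) × Path) : ℝ≥0∞ :=
  ((∑ i ∈ Finset.range (popSize n q.2), q.2.1 n i : ℕ) : ℝ≥0∞)
    / ∏ k ∈ Finset.range (n + 1), L.mean (q.1 k)

@[fun_prop]
lemma measurable_normalizedImmigration (L : Laws Θ) (n : ℕ) :
    Measurable (L.normalizedImmigration n) := by
  unfold normalizedImmigration
  refine Measurable.div (by fun_prop) (Finset.measurable_prod _ fun k _ => by fun_prop)

@[fun_prop]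
lemma measurable_normalizedOffspring (L : Laws Θ) (n : ℕ) :
    Measurable (L.normalizedOffspring n) := by
  unfold normalizedOffspring
  refine Measurable.div ?_ (Finset.measurable_prod _ fun k _ => by fun_prop)
  exact measurable_from_top.comp (measurable_sum_range (by fun_prop) fun i => by fun_prop)

lemma normalized_succ (L : Laws Θ) (n : ℕ) (q : (ℕ → Θ) × Path) :
    L.normalized (n + 1) q = L.normalizedImmigration n q + L.normalizedOffspring n q := by
  rw [normalized, popSize_succ, Nat.cast_add, ENNReal.add_div]
  rfl

/-- Conditional Jensen for `x ^ δ`: given the past, the offspring total has mean `m_n Z_n`. The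
weight `H` makes this an inequality between conditional expectations. -/
lemma lintegral_mul_normalizedOffspring_rpow_le (he : ∀ k, L.Regular p (e k)) (n : ℕ) {δ : ℝ}
    (h0 : 0 < δ) (h1 : δ ≤ 1) {H : Path → ℝ≥0∞} (hH : Measurable H) :
    ∫⁻ z, H (past n z) * L.normalizedOffspring n (e, z) ^ δ ∂(L.quenched e)
      ≤ ∫⁻ z, H (past n z) * L.normalized n (e, z) ^ δ ∂(L.quenched e) := by
  have hm0 : L.mean (e n) ≠ 0 :=
    (zero_lt_one.trans_le (L.one_le_mean (he n).offspring_zero)).ne'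
  set D := ∏ k ∈ Finset.range n, L.mean (e k) with hD
  have hDs : ∏ k ∈ Finset.range (n + 1), L.mean (e k) = D * L.mean (e n) :=
    Finset.prod_range_succ _ _
  unfold normalizedOffspring normalized
  simp only [hDs, ← hD]
  rw [L.lintegral_offspring_sum e n (fun k => ((k : ℝ≥0∞) / (D * L.mean (e n))) ^ δ) hH]
  refine lintegral_mono fun z => mul_le_mul_right ?_ _
  simp only [div_eq_mul_inv, ENNReal.mul_rpow_of_nonneg _ _ h0.le]
  rw [lintegral_mul_const]
  · refine (mul_le_mul_left (L.lintegral_rowLaw_rpow_le (e n) _ h0 h1) _).trans (le_of_eq ?_)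
    rw [ENNReal.mul_inv (Or.inr (he n).mean_ne_top) (Or.inr hm0),
      ENNReal.mul_rpow_of_nonneg _ _ h0.le, mul_comm (L.mean (e n) ^ δ), mul_assoc,
      mul_left_comm (L.mean (e n) ^ δ), ← ENNReal.mul_rpow_of_nonneg (L.mean (e n)) _ h0.le,
      ENNReal.mul_inv_cancel hm0 (he n).mean_ne_top, ENNReal.one_rpow, mul_one]
  · refine Measurable.pow_const ?_ _
    exact measurable_from_top.comp
      (measurable_sum_range measurable_const fun i => measurable_pi_apply i)

/-- Only the earlier means are replaced by `invMean`; the factor `1 / m_n` stays with `Y_n`, as in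
the assumption on `Y_0 / m_0`. -/
lemma lintegral_normalizedImmigration_rpow_le (he : ∀ k, L.Regular p (e k)) (n : ℕ) {δ : ℝ}
    (h0 : 0 < δ) :
    ∫⁻ z, L.normalizedImmigration n (e, z) ^ δ ∂(L.quenched e)
      ≤ (∏ k ∈ Finset.range n, L.invMean (e k) ^ δ) * L.immigrationMoment δ (e n) := by
  have hm0 : L.mean (e n) ≠ 0 :=
    (zero_lt_one.trans_le (L.one_le_mean (he n).offspring_zero)).ne'
  unfold normalizedImmigration immigrationMoment
  rw [L.lintegral_quenched_immigration e n
    fun k => ((k : ℝ≥0∞) / ∏ k ∈ Finset.range (n + 1), L.mean (e k)) ^ δ,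
    ENNReal.prod_rpow_of_nonneg h0.le, ← lintegral_const_mul _ (by fun_prop)]
  refine lintegral_mono fun k => ?_
  rw [← ENNReal.mul_rpow_of_nonneg _ _ h0.le, Finset.prod_range_succ, div_eq_mul_inv,
    ENNReal.mul_inv (Or.inr (he n).mean_ne_top) (Or.inr hm0), mul_left_comm, ← div_eq_mul_inv]
  gcongr
  exact inv_prod_mean_le he _

/-- Given the environment, the moment of order `δ ≤ 1` of the normalized population size is
bounded in terms of the immigration. -/
lemma lintegral_normalized_rpow_le (he : ∀ k, L.Regular p (e k)) (n : ℕ) {δ : ℝ}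
    (h0 : 0 < δ) (h1 : δ ≤ 1) :
    ∫⁻ z, L.normalized n (e, z) ^ δ ∂(L.quenched e) ≤ 1 + ∑ k ∈ Finset.range n,
      (∏ i ∈ Finset.range k, L.invMean (e i) ^ δ) * L.immigrationMoment δ (e k) := by
  induction n with
  | zero => simp [normalized]
  | succ n ih =>
    calc _ ≤ ∫⁻ z, (L.normalizedImmigration n (e, z) ^ δ + L.normalizedOffspring n (e, z) ^ δ)
            ∂(L.quenched e) := lintegral_mono fun z => by
              rw [normalized_succ]
              exact ENNReal.rpow_add_le_add_rpow _ _ h0.le h1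
      _ = ∫⁻ z, L.normalizedImmigration n (e, z) ^ δ ∂(L.quenched e)
          + ∫⁻ z, 1 * L.normalizedOffspring n (e, z) ^ δ ∂(L.quenched e) := by
            simp only [one_mul]
            exact lintegral_add_left (by fun_prop) _
      _ ≤ (∏ k ∈ Finset.range n, L.invMean (e k) ^ δ) * L.immigrationMoment δ (e n)
          + (1 + ∑ k ∈ Finset.range n,
            (∏ i ∈ Finset.range k, L.invMean (e i) ^ δ) * L.immigrationMoment δ (e k)) := by
            refine add_le_add (lintegral_normalizedImmigration_rpow_le he n h0) ?_
            refine (lintegral_mul_normalizedOffspring_rpow_le he n h0 h1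
              (H := fun _ => 1) measurable_const).trans ?_
            simpa using ih
      _ = _ := by
            rw [Finset.sum_range_succ]
            ring

end Laws

/-- For an independent and identically distributed environment. -/
lemma lintegral_env_prod (ν : Measure Θ) [IsProbabilityMeasure ν] {g h : Θ → ℝ≥0∞}
    (hg : Measurable g) (hh : Measurable h) (k : ℕ) :
    ∫⁻ e, (∏ i ∈ Finset.range k, g (e i)) * h (e k) ∂(Measure.infinitePi fun _ : ℕ => ν)
      = (∫⁻ θ, g θ ∂ν) ^ k * ∫⁻ θ, h θ ∂ν := by
  -- One family, equal to `g` before `k` and to `h` at `k`, so that independence is used once over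
  -- `range (k + 1)`.
  have hm : ∀ i, Measurable (if i < k then g else h) := fun i => by split_ifs <;> assumption
  have hind := iIndepFun_infinitePi (P := fun _ : ℕ => ν) (X := fun i => if i < k then g else h) hm
  have h1 := lintegral_prod_eq_prod_lintegral_of_indepFun (Finset.range (k + 1)) _ hind
    fun i => (hm i).comp (measurable_pi_apply i)
  have h2 : ∀ i, ∀ f : Θ → ℝ≥0∞, Measurable f →
      ∫⁻ e : ℕ → Θ, f (e i) ∂(Measure.infinitePi fun _ : ℕ => ν) = ∫⁻ θ, f θ ∂ν := by
    intro i f hf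
    rw [← lintegral_map hf (measurable_pi_apply i), Measure.infinitePi_map_eval]
  simp only [h2 _ _ (hm _), Finset.prod_range_succ, lt_irrefl, if_false] at h1
  have h3 : ∀ e : ℕ → Θ, ∏ i ∈ Finset.range k, (if i < k then g else h) (e i)
      = ∏ i ∈ Finset.range k, g (e i) := fun e =>
    Finset.prod_congr rfl fun i hi => by rw [if_pos (Finset.mem_range.1 hi)]
  have h4 : ∏ i ∈ Finset.range k, ∫⁻ θ, (if i < k then g else h) θ ∂ν = (∫⁻ θ, g θ ∂ν) ^ k := by
    rw [Finset.prod_congr rfl fun i hi => by rw [if_pos (Finset.mem_range.1 hi)]]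
    simp
  simp only [h3, h4] at h1
  exact h1

/-! ### Quenched almost sure convergence -/

/-- The filtration of the offspring numbers and of the immigrants. -/
def pathFiltration : Filtration ℕ (inferInstance : MeasurableSpace Path) where
  seq n := MeasurableSpace.comap (past n) inferInstance
  mono' m n h := by
    have : past m = past m ∘ past n := funext fun z => (past_past h z).symm
    change MeasurableSpace.comap (past m) _ ≤ MeasurableSpace.comap (past n) _
    rw [this, ← MeasurableSpace.comap_comp]
    exact MeasurableSpace.comap_mono (measurable_past m).comap_le
  le' n := (measurable_past n).comap_le

namespace Laws

variable {L : Laws Θ} {p : ℝ} {e : ℕ → Θ}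

lemma normalized_past (L : Laws Θ) (e : ℕ → Θ) {m n : ℕ} (h : m ≤ n) (z : Path) :
    L.normalized m (e, past n z) = L.normalized m (e, z) := by
  simp only [normalized, popSize_past h]

lemma normalizedImmigration_past (L : Laws Θ) (e : ℕ → Θ) {m n : ℕ} (h : m < n) (z : Path) :
    L.normalizedImmigration m (e, past n z) = L.normalizedImmigration m (e, z) := by
  simp only [normalizedImmigration, past, if_pos h]

lemma normalized_ne_top (he : ∀ k, L.Regular p (e k)) (n : ℕ) (z : Path) :
    L.normalized n (e, z) ≠ ∞ :=
  ENNReal.div_ne_top (by simp) (prod_mean_ne_zero he _)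

lemma normalizedImmigration_ne_top (he : ∀ k, L.Regular p (e k)) (n : ℕ) (z : Path) :
    L.normalizedImmigration n (e, z) ≠ ∞ :=
  ENNReal.div_ne_top (by simp) (prod_mean_ne_zero he _)

lemma normalizedOffspring_ne_top (he : ∀ k, L.Regular p (e k)) (n : ℕ) (z : Path) :
    L.normalizedOffspring n (e, z) ≠ ∞ :=
  ENNReal.div_ne_top (by simp) (prod_mean_ne_zero he _)

/-- A power of the normalized population size minus the accumulated immigration. -/
noncomputable def compensated (L : Laws Θ) (e : ℕ → Θ) (δ : ℝ) (n : ℕ) (z : Path) : ℝ :=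
  (L.normalized n (e, z) ^ δ).toReal
    - ∑ k ∈ Finset.range n, (L.normalizedImmigration k (e, z) ^ δ).toReal

@[fun_prop]
lemma measurable_compensated (L : Laws Θ) (e : ℕ → Θ) (δ : ℝ) (n : ℕ) :
    Measurable (L.compensated e δ n) := by
  unfold compensated
  refine Measurable.sub (by fun_prop) (Finset.measurable_sum _ fun k _ => by fun_prop)

lemma tsum_lintegral_normalizedImmigration_ne_top {δ : ℝ} (he : ∀ k, L.Regular p (e k)) (h0 : 0 < δ)
    (hfin : ∑' k, (∏ i ∈ Finset.range k, L.invMean (e i) ^ δ) * L.immigrationMoment δ (e k) ≠ ∞) :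
    ∑' k, ∫⁻ z, L.normalizedImmigration k (e, z) ^ δ ∂(L.quenched e) ≠ ∞ :=
  ne_top_of_le_ne_top hfin
    (ENNReal.tsum_le_tsum fun k => lintegral_normalizedImmigration_rpow_le he k h0)

lemma lintegral_normalized_ne_top {δ : ℝ} (he : ∀ k, L.Regular p (e k)) (h0 : 0 < δ) (h1 : δ ≤ 1)
    (hfin : ∑' k, (∏ i ∈ Finset.range k, L.invMean (e i) ^ δ) * L.immigrationMoment δ (e k) ≠ ∞)
    (n : ℕ) :
    ∫⁻ z, L.normalized n (e, z) ^ δ ∂(L.quenched e) ≠ ∞ := by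
  refine ne_top_of_le_ne_top ?_ (lintegral_normalized_rpow_le he n h0 h1)
  exact ENNReal.add_ne_top.2 ⟨by simp, ne_top_of_le_ne_top hfin (ENNReal.sum_le_tsum _)⟩

lemma integrable_compensated {δ : ℝ} (he : ∀ k, L.Regular p (e k)) (h0 : 0 < δ) (h1 : δ ≤ 1)
    (hfin : ∑' k, (∏ i ∈ Finset.range k, L.invMean (e i) ^ δ) * L.immigrationMoment δ (e k) ≠ ∞)
    (n : ℕ) : Integrable (L.compensated e δ n) (L.quenched e) := by
  refine Integrable.sub (integrable_toReal_of_lintegral_ne_top (by fun_prop)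
    (lintegral_normalized_ne_top he h0 h1 hfin n)) (integrable_finsetSum _ fun k _ => ?_)
  exact integrable_toReal_of_lintegral_ne_top (by fun_prop)
    (ENNReal.ne_top_of_tsum_ne_top (tsum_lintegral_normalizedImmigration_ne_top he h0 hfin) k)

/-- By subadditivity, passing from `n` to `n + 1` adds at most the immigration term, which the
compensator removes, and the offspring term, whose conditional mean is at most the old power. -/
lemma supermartingale_compensated {δ : ℝ} (he : ∀ k, L.Regular p (e k)) (h0 : 0 < δ) (h1 : δ ≤ 1)
    (hfin : ∑' k, (∏ i ∈ Finset.range k, L.invMean (e i) ^ δ) * L.immigrationMoment δ (e k) ≠ ∞) :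
    Supermartingale (L.compensated e δ) pathFiltration (L.quenched e) := by
  refine supermartingale_of_setIntegral_succ_le (fun n => ?_)
    (integrable_compensated he h0 h1 hfin) fun n s hs => ?_
  · have : L.compensated e δ n = L.compensated e δ n ∘ past n := by
      funext z
      simp only [Function.comp, compensated, normalized_past L e le_rfl]
      congr 1
      exact Finset.sum_congr rfl fun k hk => by
        rw [normalizedImmigration_past L e (Finset.mem_range.1 hk)]
    rw [this]
    exact ((measurable_compensated L e δ n).comp (comap_measurable _)).stronglyMeasurable
  · have hsm : MeasurableSet s := pathFiltration.le n s hs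
    obtain ⟨B, hB, rfl⟩ := hs
    -- An event of the filtration is the preimage of some `B` under `past n`, so its indicator can
    -- serve as the weight `H`.
    have hO : ∫⁻ z in past n ⁻¹' B, L.normalizedOffspring n (e, z) ^ δ ∂(L.quenched e)
        ≤ ∫⁻ z in past n ⁻¹' B, L.normalized n (e, z) ^ δ ∂(L.quenched e) := by
      have := lintegral_mul_normalizedOffspring_rpow_le he n h0 h1
        (H := B.indicator fun _ => 1) (measurable_const.indicator hB)
      rw [← lintegral_indicator hsm, ← lintegral_indicator hsm]
      convert this using 3 with z z
      all_goals by_cases hz : past n z ∈ B <;> simp [hz]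
    have hW := ne_top_of_le_ne_top (lintegral_normalized_ne_top he h0 h1 hfin n)
      (setLIntegral_le_lintegral (past n ⁻¹' B) _)
    have hrp : ∀ {x : ℝ≥0∞}, x ≠ ∞ → x ^ δ ≠ ∞ := fun hx => ENNReal.rpow_ne_top_of_nonneg h0.le hx
    have hOint : IntegrableOn (fun z => (L.normalizedOffspring n (e, z) ^ δ).toReal)
        (past n ⁻¹' B) (L.quenched e) :=
      integrable_toReal_of_lintegral_ne_top (by fun_prop) (ne_top_of_le_ne_top hW hO)
    have hWint : IntegrableOn (fun z => (L.normalized n (e, z) ^ δ).toReal)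
        (past n ⁻¹' B) (L.quenched e) :=
      integrable_toReal_of_lintegral_ne_top (by fun_prop) hW
    have hreal : ∫ z in past n ⁻¹' B, (L.normalizedOffspring n (e, z) ^ δ).toReal ∂(L.quenched e)
        ≤ ∫ z in past n ⁻¹' B, (L.normalized n (e, z) ^ δ).toReal ∂(L.quenched e) := by
      rw [integral_toReal (by fun_prop) (ae_of_all _ fun z =>
          (hrp (normalizedOffspring_ne_top he n z)).lt_top),
        integral_toReal (by fun_prop) (ae_of_all _ fun z =>
          (hrp (normalized_ne_top he n z)).lt_top)]
      exact ENNReal.toReal_mono hW hO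
    have hstep : ∀ z, L.compensated e δ (n + 1) z ≤ L.compensated e δ n z
        + ((L.normalizedOffspring n (e, z) ^ δ).toReal
          - (L.normalized n (e, z) ^ δ).toReal) := by
      intro z
      have h2 : (L.normalized (n + 1) (e, z) ^ δ).toReal
          ≤ (L.normalizedImmigration n (e, z) ^ δ).toReal
            + (L.normalizedOffspring n (e, z) ^ δ).toReal := by
        rw [← ENNReal.toReal_add (hrp (normalizedImmigration_ne_top he n z))
          (hrp (normalizedOffspring_ne_top he n z)), normalized_succ]
        refine ENNReal.toReal_mono (ENNReal.add_ne_top.2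
          ⟨hrp (normalizedImmigration_ne_top he n z), hrp (normalizedOffspring_ne_top he n z)⟩) ?_
        exact ENNReal.rpow_add_le_add_rpow _ _ h0.le h1
      simp only [compensated, Finset.sum_range_succ]
      linarith
    have hint := integrable_compensated he h0 h1 hfin
    calc _ ≤ ∫ z in past n ⁻¹' B, (L.compensated e δ n z
            + ((L.normalizedOffspring n (e, z) ^ δ).toReal
              - (L.normalized n (e, z) ^ δ).toReal)) ∂(L.quenched e) :=
          integral_mono (hint _).integrableOn
            ((hint _).integrableOn.add (hOint.sub hWint)) hstep
      _ = ∫ z in past n ⁻¹' B, L.compensated e δ n z ∂(L.quenched e)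
            + (∫ z in past n ⁻¹' B, (L.normalizedOffspring n (e, z) ^ δ).toReal ∂(L.quenched e)
              - ∫ z in past n ⁻¹' B, (L.normalized n (e, z) ^ δ).toReal ∂(L.quenched e)) := by
          rw [← integral_sub hOint hWint]
          exact integral_add (hint _).integrableOn (hOint.sub hWint)
      _ ≤ _ := by linarith

lemma eLpNorm_compensated_le {δ : ℝ} (he : ∀ k, L.Regular p (e k)) (h0 : 0 < δ) (h1 : δ ≤ 1)
    (n : ℕ) :
    eLpNorm (L.compensated e δ n) 1 (L.quenched e) ≤ 1 + 2 * ∑' k,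
      (∏ i ∈ Finset.range k, L.invMean (e i) ^ δ) * L.immigrationMoment δ (e k) := by
  set S := ∑' k, (∏ i ∈ Finset.range k, L.invMean (e i) ^ δ) * L.immigrationMoment δ (e k)
  rw [eLpNorm_one_eq_lintegral_enorm]
  calc _ ≤ ∫⁻ z, (L.normalized n (e, z) ^ δ
          + ∑ k ∈ Finset.range n, L.normalizedImmigration k (e, z) ^ δ) ∂(L.quenched e) := by
        refine lintegral_mono fun z => ?_
        refine enorm_sub_le.trans (add_le_add ?_ ?_)
        · rw [Real.enorm_of_nonneg ENNReal.toReal_nonneg]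
          exact ENNReal.ofReal_toReal_le
        · refine (enorm_sum_le _ _).trans (Finset.sum_le_sum fun k _ => ?_)
          rw [Real.enorm_of_nonneg ENNReal.toReal_nonneg]
          exact ENNReal.ofReal_toReal_le
    _ = ∫⁻ z, L.normalized n (e, z) ^ δ ∂(L.quenched e)
          + ∑ k ∈ Finset.range n, ∫⁻ z, L.normalizedImmigration k (e, z) ^ δ ∂(L.quenched e) := by
        rw [lintegral_add_left (by fun_prop), lintegral_finsetSum _ fun k _ => by fun_prop]
    _ ≤ (1 + S) + S := by
        refine add_le_add ((lintegral_normalized_rpow_le he n h0 h1).trans ?_) ?_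
        · gcongr
          exact ENNReal.sum_le_tsum _
        · refine (Finset.sum_le_sum fun k _ =>
            lintegral_normalizedImmigration_rpow_le he k h0).trans (ENNReal.sum_le_tsum _)
    _ = _ := by ring

/-- Given the environment, the normalized population sizes converge almost surely. -/
lemma ae_tendsto_normalized {δ : ℝ} (he : ∀ k, L.Regular p (e k)) (h0 : 0 < δ) (h1 : δ ≤ 1)
    (hfin : ∑' k, (∏ i ∈ Finset.range k, L.invMean (e i) ^ δ) * L.immigrationMoment δ (e k) ≠ ∞) :
    ∀ᵐ z ∂(L.quenched e), Filter.Tendsto (fun n => L.normalized n (e, z)) Filter.atTop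
      (nhds (Filter.limsup (fun n => L.normalized n (e, z)) Filter.atTop)) := by
  have hR : (1 + 2 * ∑' k, (∏ i ∈ Finset.range k, L.invMean (e i) ^ δ)
      * L.immigrationMoment δ (e k)) ≠ ∞ :=
    ENNReal.add_ne_top.2 ⟨by simp, ENNReal.mul_ne_top (by simp) hfin⟩
  have hconv := (supermartingale_compensated he h0 h1 hfin).neg.exists_ae_tendsto_of_bdd
    (R := ENNReal.toNNReal _) fun n => by
      rw [ENNReal.coe_toNNReal hR, Pi.neg_apply, eLpNorm_neg]
      exact eLpNorm_compensated_le he h0 h1 n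
  have hsum : ∀ᵐ z ∂(L.quenched e), ∑' k, L.normalizedImmigration k (e, z) ^ δ < ∞ := by
    refine ae_lt_top (Measurable.tsum fun k => by fun_prop) ?_
    rw [lintegral_tsum fun k => by fun_prop]
    exact tsum_lintegral_normalizedImmigration_ne_top he h0 hfin
  filter_upwards [hconv, hsum] with z ⟨c, hc⟩ hz
  -- Adding the convergent immigration series back to the convergent compensated process shows that
  -- the power `δ` of the normalized size converges; the continuous power `δ⁻¹` then recovers the
  -- size itself.
  have h2 := (ENNReal.summable_toReal hz.ne).hasSum.tendsto_sum_nat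
  have h3 := h2.sub hc
  have h4 : Filter.Tendsto (fun n => (L.normalized n (e, z) ^ δ).toReal) Filter.atTop
      (nhds (∑' k, (L.normalizedImmigration k (e, z) ^ δ).toReal - c)) := by
    refine h3.congr fun n => ?_
    simp [compensated]
  have h5 := ((ENNReal.continuous_rpow_const (y := δ⁻¹)).tendsto _).comp
    (ENNReal.tendsto_ofReal h4)
  obtain ⟨w, h6⟩ : ∃ w, Filter.Tendsto (fun n => L.normalized n (e, z)) Filter.atTop (nhds w) := by
    refine ⟨_, h5.congr fun n => ?_⟩
    rw [Function.comp, ENNReal.ofReal_toReal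
      (ENNReal.rpow_ne_top_of_nonneg h0.le (normalized_ne_top he n z)),
      ENNReal.rpow_rpow_inv h0.ne']
  rw [h6.limsup_eq]
  exact h6

end Laws

/-! ### The absolute logarithm, and some inequalities -/

lemma absLog_ofReal {x : ℝ} (hx : 0 < x) :
    absLog (ENNReal.ofReal x) = ENNReal.ofReal |Real.log x| := by
  rw [absLog, ENNReal.log_ofReal_of_pos hx, EReal.abs_def]

lemma absLog_inv (x : ℝ≥0∞) : absLog x⁻¹ = absLog x := by
  rw [absLog, ENNReal.log_inv, EReal.abs_neg, absLog]

lemma absLog_eq_toENNReal (x : ℝ≥0∞) :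
    absLog x = (max (ENNReal.log x) (-ENNReal.log x)).toENNReal := by
  rw [absLog]
  induction ENNReal.log x with
  | bot => simp
  | top => simp
  | coe y =>
    rw [EReal.abs_def, ← EReal.coe_neg, ← EReal.coe_strictMono.monotone.map_max,
      EReal.toENNReal_of_ne_top (by simp)]
    rfl

/-- Continuity includes the points 0 and `∞`, so the limit of `W_n` can be handled before it is
known to be positive and finite. -/
lemma continuous_absLog : Continuous absLog := by
  rw [funext absLog_eq_toENNReal]
  exact EReal.continuous_toENNReal.comp
    (ENNReal.continuous_log.max (continuous_neg.comp ENNReal.continuous_log))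

@[fun_prop]
lemma measurable_absLog : Measurable absLog := continuous_absLog.measurable

lemma absLog_le_of_le_one {x y : ℝ≥0∞} (hxy : x ≤ y) (hy : y ≤ 1) : absLog y ≤ absLog x := by
  have h : ∀ {u : ℝ≥0∞}, u ≤ 1 → absLog u = (-ENNReal.log u).toENNReal := fun {u} hu => by
    have h1 : ENNReal.log u ≤ 0 := ENNReal.log_le_zero_iff.2 hu
    rw [absLog_eq_toENNReal, max_eq_right (h1.trans (EReal.neg_nonneg.2 h1))]
  rw [h hy, h (hxy.trans hy)]
  exact EReal.toENNReal_le_toENNReal (EReal.neg_le_neg_iff.2 (ENNReal.log_le_log hxy))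

lemma absLog_mul_le {x y : ℝ≥0∞} (hx0 : x ≠ 0) (hx : x ≠ ∞) (hy0 : y ≠ 0) (hy : y ≠ ∞) :
    absLog (x * y) ≤ absLog x + absLog y := by
  have hx' := ENNReal.toReal_pos hx0 hx
  have hy' := ENNReal.toReal_pos hy0 hy
  rw [← ENNReal.ofReal_toReal hx, ← ENNReal.ofReal_toReal hy, ← ENNReal.ofReal_mul hx'.le,
    absLog_ofReal hx', absLog_ofReal hy', absLog_ofReal (by positivity),
    ← ENNReal.ofReal_add (abs_nonneg _) (abs_nonneg _), Real.log_mul hx'.ne' hy'.ne']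
  exact ENNReal.ofReal_le_ofReal (abs_add_le _ _)

lemma absLog_prod_le {s : Finset ℕ} {f : ℕ → ℝ≥0∞} (h0 : ∀ i, f i ≠ 0) (h : ∀ i, f i ≠ ∞) :
    absLog (∏ i ∈ s, f i) ≤ ∑ i ∈ s, absLog (f i) := by
  induction s using Finset.cons_induction with
  | empty => simp [absLog]
  | cons i s hi ih =>
    rw [Finset.prod_cons, Finset.sum_cons]
    exact (absLog_mul_le (h0 i) (h i) (Finset.prod_ne_zero_iff.2 fun j _ => h0 j)
      (ENNReal.prod_ne_top fun j _ => h j)).trans (by gcongr)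

lemma absLog_rpow_le {x : ℝ≥0∞} (hx : 1 ≤ x) {r δ : ℝ} (hr : 0 < r) (hδ : 0 < δ) :
    absLog x ^ r ≤ ENNReal.ofReal ((r / δ) ^ r) * x ^ δ := by
  rcases eq_or_ne x ∞ with rfl | hx'
  · rw [ENNReal.top_rpow_of_pos hδ, ENNReal.mul_top]
    · exact le_top
    · exact (ENNReal.ofReal_pos.2 (by positivity)).ne'
  have h1 : 1 ≤ x.toReal := by
    rw [← ENNReal.toReal_one]; exact ENNReal.toReal_mono hx' hx
  have h0 : 0 < x.toReal := by linarith
  rw [← ENNReal.ofReal_toReal hx', absLog_ofReal h0,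
    ENNReal.ofReal_rpow_of_nonneg (abs_nonneg _) hr.le, ENNReal.ofReal_rpow_of_pos h0,
    ← ENNReal.ofReal_mul (by positivity), abs_of_nonneg (Real.log_nonneg h1)]
  refine ENNReal.ofReal_le_ofReal ?_
  calc Real.log x.toReal ^ r ≤ (x.toReal ^ (δ / r) / (δ / r)) ^ r :=
        Real.rpow_le_rpow (Real.log_nonneg h1) (Real.log_le_rpow_div h0.le (by positivity)) hr.le
    _ = _ := by
        rw [Real.div_rpow (by positivity) (by positivity), ← Real.rpow_mul h0.le,
          div_mul_cancel₀ _ hr.ne', Real.div_rpow hδ.le hr.le, Real.div_rpow hr.le hδ.le]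
        field_simp

/-- Each term is at most `(∑ f i ^ a) ^ (1 / a)`. This is crude but covers all `a > 0` at once, and
a polynomial factor is harmless against geometric decay. -/
lemma sum_rpow_le (N : ℕ) (f : ℕ → ℝ≥0∞) {a : ℝ} (ha : 0 < a) :
    (∑ i ∈ Finset.range N, f i) ^ a ≤ (N : ℝ≥0∞) ^ a * ∑ i ∈ Finset.range N, f i ^ a := by
  have h : ∀ i ∈ Finset.range N, f i ≤ (∑ i ∈ Finset.range N, f i ^ a) ^ a⁻¹ := fun i hi => by
    rw [ENNReal.le_rpow_inv_iff ha]
    exact Finset.single_le_sum (f := fun i => f i ^ a) (fun _ _ => zero_le) hi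
  refine (ENNReal.rpow_le_rpow (Finset.sum_le_card_nsmul _ _ _ h) ha.le).trans ?_
  rw [nsmul_eq_mul, ENNReal.mul_rpow_of_nonneg _ _ ha.le, ENNReal.rpow_inv_rpow ha.ne',
    Finset.card_range]

lemma tsum_rpow_mul_pow_lt_top {q : ℝ≥0∞} (hq : q < 1) (b : ℝ) :
    ∑' j : ℕ, ((j + 1 : ℕ) : ℝ≥0∞) ^ b * q ^ j < ∞ := by
  obtain ⟨k, hk⟩ := exists_nat_ge b
  have hqr : q.toReal < 1 := by
    simpa using (ENNReal.toReal_lt_toReal (ne_top_of_lt hq) (by simp)).2 hq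
  -- The midpoint of `q` and 1 is below 1 and positive even for `q = 0`, so the index shift may
  -- divide by it.
  set r := (q.toReal + 1) / 2 with hr
  have hr0 : 0 < r := by have : 0 ≤ q.toReal := ENNReal.toReal_nonneg; positivity
  have hqle : q ≤ ENNReal.ofReal r := by
    rw [← ENNReal.ofReal_toReal (ne_top_of_lt hq)]
    exact ENNReal.ofReal_le_ofReal (by linarith)
  have hs : Summable fun j : ℕ => ((j + 1 : ℕ) : ℝ) ^ k * r ^ j := by
    have := (summable_nat_add_iff 1).2
      (summable_pow_mul_geometric_of_norm_lt_one k (r := r)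
        (by rw [Real.norm_of_nonneg hr0.le]; linarith))
    refine (this.mul_right r⁻¹).congr fun j => ?_
    rw [pow_succ r]
    field_simp
  refine lt_of_le_of_lt (ENNReal.tsum_le_tsum fun j => ?_) hs.tsum_ofReal_lt_top
  rw [ENNReal.ofReal_mul (by positivity), ENNReal.ofReal_pow (by positivity),
    ENNReal.ofReal_pow hr0.le, ENNReal.ofReal_natCast]
  gcongr
  rw [← ENNReal.rpow_natCast]
  exact ENNReal.rpow_le_rpow_of_exponent_le (by exact_mod_cast Nat.le_add_left 1 j) hk

/-- Hölder with exponent `a / r`, applied to `f ^ r` and the indicator of `B`. -/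
lemma setLIntegral_rpow_le {α : Type*} [MeasurableSpace α] (μ : Measure α) {f : α → ℝ≥0∞}
    (hf : AEMeasurable f μ) {B : Set α} (hB : MeasurableSet B) {r a : ℝ} (hr : 0 < r)
    (hra : r < a) :
    ∫⁻ x in B, f x ^ r ∂μ ≤ (∫⁻ x, f x ^ a ∂μ) ^ (r / a) * μ B ^ (1 - r / a) := by
  have ha : 0 < a := hr.trans hra
  have hpq : (a / r).HolderConjugate (1 - r / a)⁻¹ := by
    rw [Real.holderConjugate_iff]
    refine ⟨(one_lt_div hr).2 hra, by simp⟩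
  have hq : (1 - r / a)⁻¹ ≠ 0 := hpq.symm.ne_zero
  have := ENNReal.lintegral_mul_le_Lp_mul_Lq μ hpq (hf.pow_const r)
    (g := B.indicator fun _ => 1) ((measurable_const.indicator hB).aemeasurable)
  have e1 : ∀ x, ((fun x => f x ^ r) * B.indicator fun _ => (1 : ℝ≥0∞)) x
      = B.indicator (fun x => f x ^ r) x := fun x => by
    by_cases hx : x ∈ B <;> simp [hx]
  have e2 : ∀ x, (B.indicator (fun _ => (1 : ℝ≥0∞)) x) ^ (1 - r / a)⁻¹
      = B.indicator (fun _ => 1) x := fun x => by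
    by_cases hx : x ∈ B
    · simp [hx]
    · simp only [hx, not_false_eq_true, Set.indicator_of_notMem]
      exact ENNReal.zero_rpow_of_pos hpq.symm.pos
  simp only [e1, e2, ← ENNReal.rpow_mul, lintegral_indicator hB] at this
  rw [show r * (a / r) = a by field_simp, show 1 / (a / r) = r / a by field_simp] at this
  simpa using this

/-- If `f ^ κ ≤ 1` had integral 1, it would equal 1 almost everywhere, and so would `f`. -/
lemma lintegral_rpow_lt_one {α : Type*} [MeasurableSpace α] {μ : Measure α}
    [IsProbabilityMeasure μ] {f : α → ℝ≥0∞} (hle : ∀ᵐ x ∂μ, f x ≤ 1)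
    (hlt : ∫⁻ x, f x ∂μ < 1) {κ : ℝ} (hκ : 0 < κ) : ∫⁻ x, f x ^ κ ∂μ < 1 := by
  by_contra! h
  have h1 : (fun x => f x ^ κ) ≤ᵐ[μ] fun _ => 1 := by
    filter_upwards [hle] with x hx using ENNReal.rpow_le_one hx hκ.le
  have h2 := ae_eq_of_ae_le_of_lintegral_le h1
    (ne_top_of_le_ne_top (by simp) (lintegral_mono_ae h1)) aemeasurable_const
    (by simpa using h)
  refine hlt.ne ?_
  calc ∫⁻ x, f x ∂μ = ∫⁻ _, 1 ∂μ := lintegral_congr_ae (by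
        filter_upwards [h2] with x hx
        simpa [hκ.ne'] using congrArg (· ^ κ⁻¹) hx)
    _ = 1 := by simp

/-! ### Decomposition of the logarithm of the normalized size -/

namespace Laws

variable {L : Laws Θ} {p : ℝ} {e : ℕ → Θ}

lemma ae_popSize_ne_zero (he : ∀ k, L.Regular p (e k)) (n : ℕ) :
    ∀ᵐ z ∂(L.quenched e), popSize n z ≠ 0 := by
  have h : ∫⁻ z, (popSize n z : ℝ≥0∞)⁻¹ ∂(L.quenched e) ≠ ∞ :=
    ne_top_of_le_ne_top (ENNReal.prod_ne_top fun i _ => ne_top_of_le_ne_top (by simp)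
      (L.invMean_le_one (he i).offspring_zero)) (L.lintegral_inv_popSize_le e n)
  filter_upwards [ae_lt_top (by fun_prop) h] with z hz h0
  simp [h0] at hz

/-- The event that the population at time `n` is smaller, after normalization, than it would be
with a single individual at time `j`. -/
def lowerTail (L : Laws Θ) (j n : ℕ) : Set ((ℕ → Θ) × Path) :=
  {q | L.normalized n q < (∏ k ∈ Finset.range j, L.mean (q.1 k))⁻¹}

lemma measurableSet_lowerTail (L : Laws Θ) (j n : ℕ) : MeasurableSet (L.lowerTail j n) :=
  measurableSet_lt (by fun_prop) (Finset.measurable_prod _ fun k _ => by fun_prop).inv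

/-- Above 1, the logarithm is dominated by a power. Below 1, the thresholds `1 / (m_0 ⋯ m_{j-1})`
are compared with the normalized size: the first one not exceeding it bounds the logarithm, and the
one before it gives a lower tail event. -/
lemma absLog_normalized_rpow_le (he : ∀ k, L.Regular p (e k)) {n : ℕ} {z : Path}
    (hz : popSize n z ≠ 0) {r δ : ℝ} (hr : 0 < r) (hδ : 0 < δ) :
    absLog (L.normalized n (e, z)) ^ r ≤
      ENNReal.ofReal ((r / δ) ^ r) * L.normalized n (e, z) ^ δ
        + ∑ j ∈ Finset.range n, (L.lowerTail j n).indicator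
          (fun q => (∑ i ∈ Finset.range (j + 1), absLog (L.mean (q.1 i))) ^ r) (e, z) := by
  rcases le_or_gt 1 (L.normalized n (e, z)) with hw | hw
  · exact (absLog_rpow_le hw hr hδ).trans le_self_add
  refine le_trans ?_ le_add_self
  -- The index `n` works because the population is at least 1.
  have hex : ∃ j, (∏ k ∈ Finset.range j, L.mean (e k))⁻¹ ≤ L.normalized n (e, z) := by
    refine ⟨n, ?_⟩
    rw [normalized, ← one_div]
    gcongr
    exact_mod_cast Nat.one_le_iff_ne_zero.2 hz
  classical
  have hJn : Nat.find hex ≤ n := Nat.find_min' hex (by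
    rw [normalized, ← one_div]
    gcongr
    exact_mod_cast Nat.one_le_iff_ne_zero.2 hz)
  have hJ := Nat.find_spec hex
  have hJmin := fun m hm => Nat.find_min hex (m := m) hm
  generalize Nat.find hex = J at hJ hJmin hJn
  -- The threshold at index 0 is 1, which the size does not reach in this case; hence `J = j + 1`,
  -- and minimality fails at `j`.
  obtain _ | j := J
  · simp at hJ
    exact absurd hw hJ.not_gt
  have hmem : (e, z) ∈ L.lowerTail j n := not_le.1 (hJmin j (Nat.lt_succ_self j))
  refine le_trans ?_ (Finset.single_le_sum (fun _ _ => zero_le)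
    (Finset.mem_range.2 (Nat.lt_of_succ_le hJn)))
  rw [Set.indicator_of_mem hmem]
  gcongr
  refine (absLog_le_of_le_one hJ hw.le).trans ?_
  rw [absLog_inv]
  refine absLog_prod_le (fun i => ?_) fun i => (he i).mean_ne_top
  exact (zero_lt_one.trans_le (L.one_le_mean (he i).offspring_zero)).ne'

end Laws

/-! ### Averaging over the environment -/

lemma measurable_env_prod {g h : Θ → ℝ≥0∞} (hg : Measurable g) (hh : Measurable h) (k : ℕ) :
    Measurable fun e : ℕ → Θ => (∏ i ∈ Finset.range k, g (e i)) * h (e k) :=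
  (Finset.measurable_prod (Finset.range k) (f := fun i (e : ℕ → Θ) => g (e i))
    fun i _ => hg.comp (measurable_pi_apply i)).mul (hh.comp (measurable_pi_apply k))

namespace Laws

instance (L : Laws Θ) : IsMarkovKernel L.quenched := ⟨fun _ => inferInstance⟩

/-- The joint law of the environment and of the numbers of offspring and immigrants, the
environment being independent and identically distributed with marginal `ν`. -/
noncomputable def annealed (L : Laws Θ) (ν : Measure Θ) [IsProbabilityMeasure ν] :
    Measure ((ℕ → Θ) × Path) :=
  (Measure.infinitePi fun _ : ℕ => ν) ⊗ₘ L.quenched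

variable {L : Laws Θ} {p : ℝ} {ν : Measure Θ} [IsProbabilityMeasure ν]

instance : IsProbabilityMeasure (L.annealed ν) := by
  unfold annealed
  infer_instance

lemma lintegral_annealed {f : (ℕ → Θ) × Path → ℝ≥0∞} (hf : Measurable f) :
    ∫⁻ q, f q ∂(L.annealed ν)
      = ∫⁻ e, ∫⁻ z, f (e, z) ∂(L.quenched e) ∂(Measure.infinitePi fun _ : ℕ => ν) :=
  Measure.lintegral_compProd hf

lemma lintegral_annealed_env {f : (ℕ → Θ) → ℝ≥0∞} (hf : Measurable f) :
    ∫⁻ q, f q.1 ∂(L.annealed ν) = ∫⁻ e, f e ∂(Measure.infinitePi fun _ : ℕ => ν) := by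
  rw [lintegral_annealed (by fun_prop)]
  simp

lemma ae_regular (hreg : ∀ᵐ θ ∂ν, L.Regular p θ) :
    ∀ᵐ e ∂(Measure.infinitePi fun _ : ℕ => ν), ∀ k, L.Regular p (e k) :=
  ae_all_iff.2 fun k =>
    (measurePreserving_eval_infinitePi (fun _ : ℕ => ν) k).quasiMeasurePreserving.ae hreg

lemma lintegral_env_eval {f : Θ → ℝ≥0∞} (hf : Measurable f) (k : ℕ) :
    ∫⁻ e : ℕ → Θ, f (e k) ∂(Measure.infinitePi fun _ : ℕ => ν) = ∫⁻ θ, f θ ∂ν := by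
  simpa using lintegral_env_prod ν (g := fun _ => 1) measurable_const hf k

/-- Every term of the quenched bound carries a product over at least `j` independent states.
Averaging gives `ρ ^ k` with `k ≥ j`, and the geometric series from `j` on supplies the factor `(1 -
ρ)⁻¹`. -/
lemma annealed_lowerTail_le (hreg : ∀ᵐ θ ∂ν, L.Regular p θ) (hp1 : 1 < p) (hp2 : p ≤ 2) {ε : ℝ}
    (hε0 : 0 < ε) (hε1 : ε ≤ 1) {j n : ℕ} (hjn : j ≤ n) :
    L.annealed ν (L.lowerTail j n) ≤ ENNReal.ofReal (4 * Real.exp 1)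
      * (1 + (1 - ∫⁻ θ, L.invMean θ ^ ((p - 1) * ε) ∂ν)⁻¹ * ∫⁻ θ, L.moment p θ ^ ε ∂ν)
      * (∫⁻ θ, L.invMean θ ^ ((p - 1) * ε) ∂ν) ^ j := by
  set κ := (p - 1) * ε with hκ
  set ρ := ∫⁻ θ, L.invMean θ ^ κ ∂ν with hρ
  set M := ∫⁻ θ, L.moment p θ ^ ε ∂ν with hM
  have hg : Measurable fun θ => L.invMean θ ^ κ := by fun_prop
  have hprod : ∀ k, Measurable fun e : ℕ → Θ => ∏ i ∈ Finset.range k, L.invMean (e i) ^ κ :=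
    fun k => Finset.measurable_prod _ fun i _ => by fun_prop
  calc L.annealed ν (L.lowerTail j n)
      = ∫⁻ e, L.quenched e (Prod.mk e ⁻¹' L.lowerTail j n) ∂(Measure.infinitePi fun _ : ℕ => ν) :=
        Measure.compProd_apply (L.measurableSet_lowerTail j n)
    _ ≤ ∫⁻ e, ENNReal.ofReal (4 * Real.exp 1) *
        (∏ i ∈ Finset.range j, L.invMean (e i) ^ κ
          + ∑ k ∈ Finset.Ico j n, (∏ i ∈ Finset.range k, L.invMean (e i) ^ κ)
              * L.moment p (e k) ^ ε) ∂(Measure.infinitePi fun _ : ℕ => ν) := by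
        refine lintegral_mono_ae ?_
        filter_upwards [ae_regular hreg] with e he
        exact quenched_normalized_lt_le he hp1 hp2 hε0 hε1 hjn
    _ = ENNReal.ofReal (4 * Real.exp 1) * (ρ ^ j + ∑ k ∈ Finset.Ico j n, ρ ^ k * M) := by
        have hm := fun k => measurable_env_prod hg
          ((L.measurable_moment p).pow_const ε) k
        rw [lintegral_const_mul _ (by
            exact (hprod j).add (Finset.measurable_sum _ fun k _ => hm k)),
          lintegral_add_left (hprod j), lintegral_finsetSum _ fun k _ => hm k]
        have h1 := lintegral_env_prod ν hg (measurable_const (a := (1 : ℝ≥0∞))) j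
        simp only [mul_one, lintegral_const, measure_univ] at h1
        rw [h1]
        congr 2
        exact Finset.sum_congr rfl fun k _ => lintegral_env_prod ν hg
          ((L.measurable_moment p).pow_const ε) k
    _ ≤ ENNReal.ofReal (4 * Real.exp 1) * (ρ ^ j + ρ ^ j * ((1 - ρ)⁻¹ * M)) := by
        gcongr
        rw [Finset.sum_Ico_eq_sum_range, ← ENNReal.tsum_geometric, ← ENNReal.tsum_mul_right,
          ← ENNReal.tsum_mul_left]
        refine le_trans (Finset.sum_le_sum fun i _ => ?_)
          (ENNReal.sum_le_tsum (Finset.range (n - j)))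
        rw [pow_add, mul_assoc]
    _ = _ := by ring

lemma lintegral_tsum_immigrationMoment (L : Laws Θ) (ν : Measure Θ)
    [IsProbabilityMeasure ν] (δ : ℝ) :
    ∫⁻ e, ∑' k, (∏ i ∈ Finset.range k, L.invMean (e i) ^ δ) * L.immigrationMoment δ (e k)
        ∂(Measure.infinitePi fun _ : ℕ => ν)
      = (1 - ∫⁻ θ, L.invMean θ ^ δ ∂ν)⁻¹ * ∫⁻ θ, L.immigrationMoment δ θ ∂ν := by
  rw [lintegral_tsum fun k => (measurable_env_prod (L.measurable_invMean.pow_const δ)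
    (L.measurable_immigrationMoment δ) k).aemeasurable, ← ENNReal.tsum_geometric,
    ← ENNReal.tsum_mul_right]
  exact tsum_congr fun k => lintegral_env_prod ν (L.measurable_invMean.pow_const δ)
    (L.measurable_immigrationMoment δ) k

lemma lintegral_annealed_normalized_rpow_le (hreg : ∀ᵐ θ ∂ν, L.Regular p θ) {δ : ℝ} (h0 : 0 < δ)
    (h1 : δ ≤ 1) (n : ℕ) :
    ∫⁻ q, L.normalized n q ^ δ ∂(L.annealed ν)
      ≤ 1 + (1 - ∫⁻ θ, L.invMean θ ^ δ ∂ν)⁻¹ * ∫⁻ θ, L.immigrationMoment δ θ ∂ν := by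
  rw [lintegral_annealed (by fun_prop)]
  calc _ ≤ ∫⁻ e, (1 + ∑' k, (∏ i ∈ Finset.range k, L.invMean (e i) ^ δ)
          * L.immigrationMoment δ (e k)) ∂(Measure.infinitePi fun _ : ℕ => ν) := by
        refine lintegral_mono_ae ?_
        filter_upwards [ae_regular hreg] with e he
        refine (lintegral_normalized_rpow_le he n h0 h1).trans ?_
        gcongr
        exact ENNReal.sum_le_tsum _
    _ = _ := by
        rw [lintegral_add_left measurable_const, lintegral_tsum_immigrationMoment]
        simp

lemma invMean_rpow_lt_one (hreg : ∀ᵐ θ ∂ν, L.Regular p θ) (hlt : ∫⁻ θ, L.invMean θ ∂ν < 1)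
    {κ : ℝ} (hκ : 0 < κ) : ∫⁻ θ, L.invMean θ ^ κ ∂ν < 1 :=
  lintegral_rpow_lt_one (hreg.mono fun _ h => L.invMean_le_one h.offspring_zero) hlt hκ

lemma inv_one_sub_ne_top {x : ℝ≥0∞} (hx : x < 1) : (1 - x)⁻¹ ≠ ∞ :=
  ENNReal.inv_ne_top.2 (tsub_pos_of_lt hx).ne'

/-- The normalized population sizes converge almost surely. -/
lemma ae_annealed_tendsto_normalized (hreg : ∀ᵐ θ ∂ν, L.Regular p θ)
    (hlt : ∫⁻ θ, L.invMean θ ∂ν < 1) {δ : ℝ} (h0 : 0 < δ) (h1 : δ ≤ 1)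
    (hI : ∫⁻ θ, L.immigrationMoment δ θ ∂ν ≠ ∞) :
    ∀ᵐ q ∂(L.annealed ν), Filter.Tendsto (fun n => L.normalized n q) Filter.atTop
      (nhds (Filter.limsup (fun n => L.normalized n q) Filter.atTop)) := by
  have hms : MeasurableSet {q : (ℕ → Θ) × Path |
      Filter.Tendsto (fun n => L.normalized n q) Filter.atTop
        (nhds (Filter.limsup (fun n => L.normalized n q) Filter.atTop))} := by
    -- Convergence to the upper limit means that the upper limit is at most the lower limit, which
    -- is visibly a measurable condition.
    have hset : {q : (ℕ → Θ) × Path | Filter.Tendsto (fun n => L.normalized n q) Filter.atTop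
        (nhds (Filter.limsup (fun n => L.normalized n q) Filter.atTop))}
      = {q | Filter.limsup (fun n => L.normalized n q) Filter.atTop
          ≤ Filter.liminf (fun n => L.normalized n q) Filter.atTop} := by
      ext q
      refine ⟨fun h => h.liminf_eq.ge, fun h => ?_⟩
      exact tendsto_of_le_liminf_of_limsup_le h le_rfl
    rw [hset]
    exact measurableSet_le (Measurable.limsup fun n => by fun_prop)
      (Measurable.liminf fun n => by fun_prop)
  refine (Measure.ae_compProd_iff hms).2 ?_
  have hfin : ∀ᵐ e ∂(Measure.infinitePi fun _ : ℕ => ν), ∑' k,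
      (∏ i ∈ Finset.range k, L.invMean (e i) ^ δ) * L.immigrationMoment δ (e k) < ∞ := by
    refine ae_lt_top (Measurable.tsum fun k => Measurable.mul
      (Finset.measurable_prod _ fun i _ => by fun_prop) (by fun_prop)) ?_
    rw [lintegral_tsum_immigrationMoment]
    exact ENNReal.mul_ne_top (inv_one_sub_ne_top (invMean_rpow_lt_one hreg hlt h0)) hI
  filter_upwards [ae_regular hreg, hfin] with e he hf
  exact ae_tendsto_normalized he h0 h1 hf.ne

lemma lintegral_sum_absLog_rpow_le {a : ℝ} (ha : 0 < a) (N : ℕ) :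
    ∫⁻ q, (∑ i ∈ Finset.range N, absLog (L.mean (q.1 i))) ^ a ∂(L.annealed ν)
      ≤ (N : ℝ≥0∞) ^ (a + 1) * ∫⁻ θ, absLog (L.mean θ) ^ a ∂ν := by
  rw [lintegral_annealed_env
    (f := fun e => (∑ i ∈ Finset.range N, absLog (L.mean (e i))) ^ a)
    (Measurable.pow_const (Finset.measurable_sum _ fun i _ => by fun_prop) _)]
  calc _ ≤ ∫⁻ e : ℕ → Θ, (N : ℝ≥0∞) ^ a * ∑ i ∈ Finset.range N, absLog (L.mean (e i)) ^ a
          ∂(Measure.infinitePi fun _ : ℕ => ν) := lintegral_mono fun e => sum_rpow_le N _ ha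
    _ = (N : ℝ≥0∞) ^ a * (N * ∫⁻ θ, absLog (L.mean θ) ^ a ∂ν) := by
        rw [lintegral_const_mul _ (Finset.measurable_sum _ fun i _ => by fun_prop),
          lintegral_finsetSum _ fun i _ => by fun_prop,
          Finset.sum_congr rfl fun i _ => lintegral_env_eval
            (f := fun θ => absLog (L.mean θ) ^ a) (by fun_prop) i]
        simp
    _ = _ := by
        rw [← mul_assoc, ENNReal.rpow_add_of_nonneg _ _ ha.le zero_le_one, ENNReal.rpow_one]

/-- The moments of order `r < a` of the logarithms of the normalized population sizes are
bounded. -/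
lemma iSup_lintegral_absLog_normalized_lt_top (hreg : ∀ᵐ θ ∂ν, L.Regular p θ)
    (hlt : ∫⁻ θ, L.invMean θ ∂ν < 1) (hp1 : 1 < p) (hp2 : p ≤ 2) {ε : ℝ} (hε0 : 0 < ε)
    (hε1 : ε ≤ 1) (hM : ∫⁻ θ, L.moment p θ ^ ε ∂ν ≠ ∞) {δ : ℝ} (h0 : 0 < δ) (h1 : δ ≤ 1)
    (hI : ∫⁻ θ, L.immigrationMoment δ θ ∂ν ≠ ∞) {a r : ℝ} (hr : 0 < r) (hra : r < a)
    (hl : ∫⁻ θ, absLog (L.mean θ) ^ a ∂ν ≠ ∞) :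
    ⨆ n, ∫⁻ q, absLog (L.normalized n q) ^ r ∂(L.annealed ν) < ∞ := by
  have ha : 0 < a := hr.trans hra
  have hκ : 0 < (p - 1) * ε := mul_pos (by linarith) hε0
  have hs0 : 0 < r / a := by positivity
  have hs1 : 0 < 1 - r / a := sub_pos.2 ((div_lt_one ha).2 hra)
  set ρ := ∫⁻ θ, L.invMean θ ^ ((p - 1) * ε) ∂ν with hρ
  have hρ1 : ρ < 1 := invMean_rpow_lt_one hreg hlt hκ
  set K := ENNReal.ofReal (4 * Real.exp 1) * (1 + (1 - ρ)⁻¹ * ∫⁻ θ, L.moment p θ ^ ε ∂ν) with hK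
  have hKtop : K ≠ ∞ := ENNReal.mul_ne_top ENNReal.ofReal_ne_top
    (ENNReal.add_ne_top.2 ⟨by simp, ENNReal.mul_ne_top (inv_one_sub_ne_top hρ1) hM⟩)
  set l := ∫⁻ θ, absLog (L.mean θ) ^ a ∂ν with hldef
  set B := ENNReal.ofReal ((r / δ) ^ r)
    * (1 + (1 - ∫⁻ θ, L.invMean θ ^ δ ∂ν)⁻¹ * ∫⁻ θ, L.immigrationMoment δ θ ∂ν) with hB
  have hBtop : B ≠ ∞ := ENNReal.mul_ne_top (by simp) (ENNReal.add_ne_top.2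
    ⟨by simp, ENNReal.mul_ne_top (inv_one_sub_ne_top (invMean_rpow_lt_one hreg hlt h0)) hI⟩)
  -- The sum over `j` of the Hölder bounds: `(j + 1) ^ (a + 1) * l` bounds the `a`-th moment of the
  -- sum of logarithms, `K * ρ ^ j` the probability of the tail event.
  set T : ℝ≥0∞ := l ^ (r / a) * K ^ (1 - r / a) * ∑' j : ℕ,
    ((j + 1 : ℕ) : ℝ≥0∞) ^ ((a + 1) * (r / a)) * (ρ ^ (1 - r / a)) ^ j with hT
  have hTtop : T ≠ ∞ := by
    refine ENNReal.mul_ne_top (ENNReal.mul_ne_top (ENNReal.rpow_ne_top_of_nonneg hs0.le hl)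
      (ENNReal.rpow_ne_top_of_nonneg hs1.le hKtop)) ?_
    exact (tsum_rpow_mul_pow_lt_top (ENNReal.rpow_lt_one hρ1 hs1) _).ne
  refine lt_of_le_of_lt (iSup_le fun n => ?_) (ENNReal.add_ne_top.2 ⟨hBtop, hTtop⟩).lt_top
  have hsum : ∀ j, Measurable fun q : (ℕ → Θ) × Path =>
      ∑ i ∈ Finset.range (j + 1), absLog (L.mean (q.1 i)) :=
    fun j => Finset.measurable_sum _ fun i _ => by fun_prop
  have hind : ∀ j, Measurable ((L.lowerTail j n).indicator
      fun q => (∑ i ∈ Finset.range (j + 1), absLog (L.mean (q.1 i))) ^ r) := fun j =>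
    ((hsum j).pow_const r).indicator (L.measurableSet_lowerTail j n)
  have hpt : ∀ᵐ q ∂(L.annealed ν), absLog (L.normalized n q) ^ r ≤
      ENNReal.ofReal ((r / δ) ^ r) * L.normalized n q ^ δ
        + ∑ j ∈ Finset.range n, (L.lowerTail j n).indicator
          (fun q => (∑ i ∈ Finset.range (j + 1), absLog (L.mean (q.1 i))) ^ r) q := by
    refine (Measure.ae_compProd_iff (measurableSet_le (by fun_prop) (Measurable.add (by fun_prop)
      (Finset.measurable_sum _ fun j _ => hind j)))).2 ?_
    filter_upwards [ae_regular hreg] with e he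
    filter_upwards [ae_popSize_ne_zero he n] with z hz
    exact absLog_normalized_rpow_le he hz hr h0
  calc _ ≤ _ := lintegral_mono_ae hpt
    _ = ENNReal.ofReal ((r / δ) ^ r) * ∫⁻ q, L.normalized n q ^ δ ∂(L.annealed ν)
        + ∑ j ∈ Finset.range n, ∫⁻ q in L.lowerTail j n,
          (∑ i ∈ Finset.range (j + 1), absLog (L.mean (q.1 i))) ^ r ∂(L.annealed ν) := by
        rw [lintegral_add_left (by fun_prop), lintegral_const_mul _ (by fun_prop),
          lintegral_finsetSum _ fun j _ => hind j]
        congr 1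
        exact Finset.sum_congr rfl fun j _ => lintegral_indicator (L.measurableSet_lowerTail j n) _
    _ ≤ B + T := by
        refine add_le_add ?_ ?_
        · exact mul_le_mul_right (lintegral_annealed_normalized_rpow_le hreg h0 h1 n) _
        · rw [hT, ← ENNReal.tsum_mul_left]
          refine le_trans (Finset.sum_le_sum fun j hj => ?_)
            (ENNReal.sum_le_tsum (Finset.range n))
          refine (setLIntegral_rpow_le _ (hsum j).aemeasurable (L.measurableSet_lowerTail j n)
            hr hra).trans ?_
          calc _ ≤ (((j + 1 : ℕ) : ℝ≥0∞) ^ (a + 1) * l) ^ (r / a) * (K * ρ ^ j) ^ (1 - r / a) := by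
                gcongr
                · exact lintegral_sum_absLog_rpow_le ha (j + 1)
                · exact annealed_lowerTail_le hreg hp1 hp2 hε0 hε1 (Finset.mem_range.1 hj).le
            _ = _ := by
                rw [ENNReal.mul_rpow_of_nonneg _ _ hs0.le, ENNReal.mul_rpow_of_nonneg _ _ hs1.le,
                  ← ENNReal.rpow_mul, ← ENNReal.rpow_natCast, ← ENNReal.rpow_natCast,
                  ← ENNReal.rpow_mul, ← ENNReal.rpow_mul, mul_comm (j : ℝ)]
                ring

end Laws

/-! ### Lowering exponents, and transfer from the model -/

lemma rpow_min_le (x : ℝ≥0∞) {s t : ℝ} (ht : 0 < t) (hst : t ≤ s) : x ^ t ≤ 1 + x ^ s := by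
  rcases le_total x 1 with hx | hx
  · exact (ENNReal.rpow_le_one hx ht.le).trans le_self_add
  · exact (ENNReal.rpow_le_rpow_of_exponent_le hx hst).trans le_add_self

lemma lintegral_rpow_ne_top_of_le {α : Type*} [MeasurableSpace α] {μ : Measure α}
    [IsProbabilityMeasure μ] {f : α → ℝ≥0∞} {s t : ℝ} (ht : 0 < t) (hst : t ≤ s)
    (h : ∫⁻ x, f x ^ s ∂μ ≠ ∞) : ∫⁻ x, f x ^ t ∂μ ≠ ∞ := by
  refine ne_top_of_le_ne_top ?_ (lintegral_mono fun x => rpow_min_le (f x) ht hst)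
  rw [lintegral_add_left measurable_const]
  exact ENNReal.add_ne_top.2 ⟨by simp, h⟩

namespace Laws

lemma moment_le_one_add (L : Laws Θ) (θ : Θ) {s t : ℝ} (ht : 0 < t) (hst : t ≤ s) :
    L.moment t θ ≤ 1 + L.moment s θ := by
  refine (lintegral_mono fun k => rpow_min_le _ ht hst).trans ?_
  rw [lintegral_add_left measurable_const]
  simp [moment]

end Laws

namespace IsModel

variable {Ω : Type*} [MeasurableSpace Ω] {P : Measure Ω} {L : Laws Θ}
  {ξ : ℕ → Ω → Θ} {X : ℕ → ℕ → Ω → ℕ} {Y : ℕ → Ω → ℕ}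

/-- The environment, the numbers of offspring and the numbers of immigrants. -/
def toPath (ξ : ℕ → Ω → Θ) (X : ℕ → ℕ → Ω → ℕ) (Y : ℕ → Ω → ℕ) (ω : Ω) : (ℕ → Θ) × Path :=
  ((fun n => ξ n ω), ((fun n i => X n i ω), (fun n => Y n ω)))

lemma measurable_toPath (h : IsModel P L ξ X Y) : Measurable (toPath ξ X Y) := by
  have h1 := h.measurable_env
  have h2 := h.measurable_offspring
  have h3 := h.measurable_immigration
  unfold toPath
  fun_prop

lemma isProbabilityMeasure_map [IsProbabilityMeasure P] (h : IsModel P L ξ X Y) :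
    IsProbabilityMeasure (P.map (ξ 0)) :=
  Measure.isProbabilityMeasure_map (h.measurable_env 0).aemeasurable

/-- The i.i.d. assumption identifies the law of the environment with an infinite product, so every
annealed statement applies to the model. -/
lemma map_toPath (h : IsModel P L ξ X Y) [IsProbabilityMeasure (P.map (ξ 0))] :
    P.map (toPath ξ X Y) = L.annealed (P.map (ξ 0)) := by
  refine h.joint_law.trans ?_
  rw [h.indep_env.map_fun_eq_infinitePi_map h.measurable_env, Laws.annealed]
  congr 2
  funext n
  exact (h.identDistrib_env n).map_eq

lemma lintegral_toPath (h : IsModel P L ξ X Y) [IsProbabilityMeasure (P.map (ξ 0))]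
    {f : (ℕ → Θ) × Path → ℝ≥0∞} (hf : Measurable f) :
    ∫⁻ ω, f (toPath ξ X Y ω) ∂P = ∫⁻ q, f q ∂(L.annealed (P.map (ξ 0))) := by
  rw [← h.map_toPath, lintegral_map hf h.measurable_toPath]

lemma lintegral_offspring [IsProbabilityMeasure P] (h : IsModel P L ξ X Y) (f : ℕ → ℝ≥0∞) :
    ∫⁻ ω, f (X 0 0 ω) ∂P = ∫⁻ θ, ∫⁻ k, f k ∂(L.offspring θ).toMeasure ∂(P.map (ξ 0)) := by
  have := h.isProbabilityMeasure_map
  have hf : Measurable f := measurable_from_top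
  refine (h.lintegral_toPath (f := fun q => f (q.2.1 0 0)) (by fun_prop)).trans ?_
  rw [Laws.lintegral_annealed (by fun_prop)]
  simp only [L.lintegral_quenched_offspring _ 0 0 f]
  exact Laws.lintegral_env_eval (L.measurable_lintegral_offspring f) 0

lemma lintegral_immigration [IsProbabilityMeasure P] (h : IsModel P L ξ X Y) (δ : ℝ) :
    ∫⁻ ω, ((Y 0 ω : ℝ≥0∞) / L.mean (ξ 0 ω)) ^ δ ∂P
      = ∫⁻ θ, L.immigrationMoment δ θ ∂(P.map (ξ 0)) := by
  have := h.isProbabilityMeasure_map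
  refine (h.lintegral_toPath (f := fun q => ((q.2.2 0 : ℝ≥0∞) / L.mean (q.1 0)) ^ δ)
    (by fun_prop)).trans ?_
  rw [Laws.lintegral_annealed (by fun_prop)]
  simp only [fun e : ℕ → Θ => L.lintegral_quenched_immigration e 0
    fun k => ((k : ℝ≥0∞) / L.mean (e 0)) ^ δ]
  exact Laws.lintegral_env_eval (L.measurable_immigrationMoment δ) 0

lemma ae_offspring_zero [IsProbabilityMeasure P] (h : IsModel P L ξ X Y)
    (hX0 : P {ω | X 0 0 ω = 0} = 0) :
    ∀ᵐ θ ∂(P.map (ξ 0)), L.offspring θ 0 = 0 := by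
  have h1 := h.lintegral_offspring (({0} : Set ℕ).indicator fun _ => 1)
  have h2 : ∫⁻ ω, (({0} : Set ℕ).indicator fun _ => (1 : ℝ≥0∞)) (X 0 0 ω) ∂P = 0 := by
    rw [← hX0]
    exact lintegral_indicator_one (h.measurable_offspring 0 0 (measurableSet_singleton 0))
  have h3 : ∀ θ, ∫⁻ k, (({0} : Set ℕ).indicator fun _ => (1 : ℝ≥0∞)) k
      ∂(L.offspring θ).toMeasure = L.offspring θ 0 := fun θ => by
    rw [lintegral_indicator (measurableSet_singleton 0)]
    simp [PMF.toMeasure_apply_singleton]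
  simp only [h2, h3] at h1
  exact (lintegral_eq_zero_iff (L.measurable_offspring 0)).1 h1.symm

/-- `1 / X ≤ 1` with equality only at `X = 1`, so a mean equal to 1 would force `X = 1` almost
surely. -/
lemma lintegral_invMean_lt_one [IsProbabilityMeasure P] (h : IsModel P L ξ X Y)
    (hX0 : P {ω | X 0 0 ω = 0} = 0)
    (hX1 : P {ω | X 0 0 ω = 1} < 1) : ∫⁻ θ, L.invMean θ ∂(P.map (ξ 0)) < 1 := by
  have h1 := h.lintegral_offspring fun k => (k : ℝ≥0∞)⁻¹
  change _ = ∫⁻ θ, L.invMean θ ∂(P.map (ξ 0)) at h1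
  rw [← h1]
  have hm := h.measurable_offspring 0 0
  have hne : ∀ᵐ ω ∂P, X 0 0 ω ≠ 0 := by simpa [ae_iff] using hX0
  have hle : (fun ω => (X 0 0 ω : ℝ≥0∞)⁻¹) ≤ᵐ[P] fun _ => 1 := by
    filter_upwards [hne] with ω hω
    rw [ENNReal.inv_le_one]
    exact_mod_cast Nat.one_le_iff_ne_zero.2 hω
  by_contra! hge
  have heq := ae_eq_of_ae_le_of_lintegral_le hle
    (ne_top_of_le_ne_top (by simp) (lintegral_mono_ae hle)) aemeasurable_const (by simpa using hge)
  refine hX1.ne ((mem_ae_iff_prob_eq_one (hm (measurableSet_singleton 1))).1 ?_)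
  filter_upwards [heq] with ω hω
  have : (X 0 0 ω : ℝ≥0∞) = 1 := by simpa using hω
  exact_mod_cast this

end IsModel

end BPIRE

/-! ### Conclusion -/

open BPIRE

theorem theorem2p1 {Θ Ω : Type*} [MeasurableSpace Θ] [MeasurableSpace Ω]
    (P : Measure Ω) [IsProbabilityMeasure P] (L : BPIRE.Laws Θ)
    (ξ : ℕ → Ω → Θ) (X : ℕ → ℕ → Ω → ℕ) (Y : ℕ → Ω → ℕ)
    (hmodel : BPIRE.IsModel P L ξ X Y)
    -- every individual has at least one child, and sometimes more than one
    (hX0 : P {ω | X 0 0 ω = 0} = 0) (hX1 : P {ω | X 0 0 ω = 1} < 1)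
    (a δ ε p : ℝ) (ha : 0 < a) (hδ : 0 < δ) (hε : 0 < ε) (hp : 1 < p)
    (hY : ∫⁻ ω, ((Y 0 ω : ℝ≥0∞) / L.mean (ξ 0 ω)) ^ δ ∂P < ∞)
    -- as `m_0 ≥ 1` almost surely, `|log m_0|` is `log m_0` here
    (hm : ∫⁻ ω, BPIRE.absLog (L.mean (ξ 0 ω)) ^ a ∂P < ∞)
    (hX : ∫⁻ ω, (L.quenchedMoment p fun n => ξ n ω) ^ ε ∂P < ∞) :
    (∀ᵐ ω ∂P, Filter.Tendsto (fun n => BPIRE.W L ξ X Y n ω) Filter.atTop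
      (nhds (BPIRE.limitW L ξ X Y ω))) ∧
    ∀ r : ℝ, 0 < r → r < a →
      (⨆ n, ∫⁻ ω, BPIRE.absLog (BPIRE.W L ξ X Y n ω) ^ r ∂P) < ∞ ∧
      ∫⁻ ω, BPIRE.absLog (BPIRE.limitW L ξ X Y ω) ^ r ∂P < ∞ := by
  have hprob := hmodel.isProbabilityMeasure_map
  set ν := P.map (ξ 0) with hν
  have hWeq : ∀ n ω, W L ξ X Y n ω = L.normalized n (IsModel.toPath ξ X Y ω) := fun n ω => by
    rw [W, Z_eq_popSize]
    rfl
  have hlim : ∀ ω, limitW L ξ X Y ω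
      = Filter.limsup (fun n => L.normalized n (IsModel.toPath ξ X Y ω)) Filter.atTop := fun ω => by
    simp only [limitW, hWeq]
  -- The estimates need `p ≤ 2`, `ε ≤ 1` and `δ ≤ 1`; the moment assumptions survive lowering the
  -- exponents because `x ^ t ≤ 1 + x ^ s` for `0 < t ≤ s`.
  have hp1 : 1 < min p 2 := lt_min hp one_lt_two
  have hε1 : 0 < min ε 1 := lt_min hε one_pos
  have hδ1 : 0 < min δ 1 := lt_min hδ one_pos
  have hl : ∫⁻ θ, absLog (L.mean θ) ^ a ∂ν ≠ ∞ := by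
    rw [hν, lintegral_map (by fun_prop) (hmodel.measurable_env 0)]
    exact hm.ne
  have hMp : ∫⁻ θ, L.moment p θ ^ ε ∂ν ≠ ∞ := by
    rw [hν, lintegral_map (by fun_prop) (hmodel.measurable_env 0)]
    simpa only [L.quenchedMoment_eq] using hX.ne
  have hM : ∫⁻ θ, L.moment (min p 2) θ ^ min ε 1 ∂ν ≠ ∞ := by
    have h1 := lintegral_rpow_ne_top_of_le hε1 (min_le_left ε 1) hMp
    refine ne_top_of_le_ne_top ?_ (lintegral_mono fun θ => ENNReal.rpow_le_rpow
      (L.moment_le_one_add θ (zero_lt_one.trans hp1) (min_le_left p 2)) hε1.le)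
    refine ne_top_of_le_ne_top ?_ (lintegral_mono fun θ =>
      ENNReal.rpow_add_le_add_rpow _ _ hε1.le (min_le_right ε 1))
    rw [lintegral_add_left measurable_const]
    exact ENNReal.add_ne_top.2 ⟨by simp, h1⟩
  have hI : ∫⁻ θ, L.immigrationMoment (min δ 1) θ ∂ν ≠ ∞ := by
    rw [← hmodel.lintegral_immigration]
    exact lintegral_rpow_ne_top_of_le hδ1 (min_le_left δ 1) hY.ne
  have hreg : ∀ᵐ θ ∂ν, L.Regular (min p 2) θ := by
    filter_upwards [hmodel.ae_offspring_zero hX0, ae_lt_top (by fun_prop) hl,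
      ae_lt_top (by fun_prop) hM] with θ h1 h2 h3
    refine ⟨h1, fun h => ?_, fun h => ?_⟩
    · simp [h, absLog, ha] at h2
    · simp [h, hε] at h3
  have hlt := hmodel.lintegral_invMean_lt_one hX0 hX1
  have hconv : ∀ᵐ ω ∂P, Filter.Tendsto (fun n => W L ξ X Y n ω) Filter.atTop
      (nhds (limitW L ξ X Y ω)) := by
    have h1 := Laws.ae_annealed_tendsto_normalized hreg hlt hδ1 (min_le_right δ 1) hI
    rw [← hmodel.map_toPath] at h1
    filter_upwards [ae_of_ae_map hmodel.measurable_toPath.aemeasurable h1] with ω hω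
    simpa only [hWeq, hlim] using hω
  refine ⟨hconv, fun r hr hra => ?_⟩
  have hsup : ⨆ n, ∫⁻ ω, absLog (W L ξ X Y n ω) ^ r ∂P < ∞ := by
    simp only [hWeq, fun n => hmodel.lintegral_toPath
      (f := fun q => absLog (L.normalized n q) ^ r) (by fun_prop)]
    exact Laws.iSup_lintegral_absLog_normalized_lt_top hreg hlt hp1 (min_le_right p 2) hε1
      (min_le_right ε 1) hM hδ1 (min_le_right δ 1) hI hr hra hl
  refine ⟨hsup, lt_of_le_of_lt ?_ hsup⟩
  have hmeas : ∀ n, Measurable fun ω => absLog (W L ξ X Y n ω) ^ r := fun n => by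
    have := hmodel.measurable_toPath
    simp only [hWeq]
    fun_prop
  -- Fatou's lemma, with continuity of `absLog` on all of `[0, ∞]`.
  calc ∫⁻ ω, absLog (limitW L ξ X Y ω) ^ r ∂P
      = ∫⁻ ω, Filter.liminf (fun n => absLog (W L ξ X Y n ω) ^ r) Filter.atTop ∂P := by
        refine lintegral_congr_ae ?_
        filter_upwards [hconv] with ω hω
        exact (((ENNReal.continuous_rpow_const.comp continuous_absLog).tendsto _).comp
          hω).liminf_eq.symm
    _ ≤ Filter.liminf (fun n => ∫⁻ ω, absLog (W L ξ X Y n ω) ^ r ∂P) Filter.atTop :=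
        lintegral_liminf_le hmeas
    _ ≤ ⨆ n, ∫⁻ ω, absLog (W L ξ X Y n ω) ^ r ∂P :=
        (Filter.liminf_le_limsup (by isBoundedDefault) (by isBoundedDefault)).trans
          Filter.limsup_le_iSup
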